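/- All operators are bounded linear operators on complex Hilbert spaces, and $\sigma_T$ denotes the Taylor joint spectrum of a commuting pair. Let $\pi(z_1,z_2)=(z_1+z_2,z_1z_2)$ and $$\mathbb G_2=\pi(\mathbb D^2),\qquad \Gamma=\pi(\overline{\mathbb D}^2),\qquad b\Gamma=\pi(\mathbb T^2).$$ A polynomial $q\in\mathbb C[z_1,z_2]$ with zero set $Z(q)$ is called $\Gamma$-distinguished if $Z(q)\cap\mathbb G_2\neq\emptyset$ and $Z(q)\cap\partial\Gamma=Z(q)\cap b\Gamma$. A commuting pair $(S,P)$ is a $\Gamma$-contraction if $\sigma_T(S,P)\subseteq\Gamma$ and $\|f(S,P)\|\le\sup_\Gamma|f|$ for every rational function $f=g/q$ with $g,q\in\mathbb C[z_1,z_2]$ and $q$ having no zeros in $\Gamma$. It is $\Gamma$-distinguished if it is a $\Gamma$-contraction and $q(S,P)=0$ for some $\Gamma$-distinguished polynomial $q$. It is a $\Gamma$-unitary if $S,P$ are normal and $\sigma_T(S,P)\subseteq b\Gamma$, and a $\Gamma$-isometry if it is the restriction of a $\Gamma$-unitary, acting on a possibly larger Hilbert space, to a joint invariant closed subspace. A pure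 $\Gamma$-isometry is a $\Gamma$-isometry $(S,P)$ for which $P$ is a pure contraction, i.e. $P^{*n}\to0$ strongly as $n\to\infty$. For a contraction $P$ put $D_P=(I-P^*P)^{1/2}$ and $\mathcal D_P=\overline{\operatorname{Ran}}\,D_P$. The fundamental operator of a $\Gamma$-contraction $(S,P)$ is the unique operator $A\in\mathcal B(\mathcal D_P)$ with $S-S^*P=D_PAD_P$. **Theorem.** Let $(S,P)$ be a pure $\Gamma$-isometry on a Hilbert space $\mathcal H$ such that $\dim\mathcal D_{P^*}<\infty$, and let $F_*\in\mathcal B(\mathcal D_{P^*})$ be the fundamental operator of $(S^*,P^*)$. Then the following are equivalent: 1. $(F_*,0)$ is $\Gamma$-distinguished; 2. $(S,P)$ is $\Gamma$-distinguished; 3. the spectral radius of $F_*$ satisfies $r(F_*)<1$. -/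

import Mathlib

open Filter Topology

universe u

noncomputable section

namespace GammaPair

/-! ## The symmetrized bidisc -/

/-- The symmetrization map `π(z₁, z₂) = (z₁ + z₂, z₁ z₂)` on `ℂ²`. -/
def symm (z : ℂ × ℂ) : ℂ × ℂ := (z.1 + z.2, z.1 * z.2)

/-- The open symmetrized bidisc `𝔾₂ = π(𝔻²)`. -/
def openSymmBidisc : Set (ℂ × ℂ) := symm '' {z | ‖z.1‖ < 1 ∧ ‖z.2‖ < 1}

/-- The closed symmetrized bidisc `Γ`, the image under `π` of the closed bidisc. -/
def closedSymmBidisc : Set (ℂ × ℂ) := symm '' {z | ‖z.1‖ ≤ 1 ∧ ‖z.2‖ ≤ 1}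

/-- The distinguished boundary `bΓ`, the symmetrization of the torus `𝕋²`. -/
def distBoundary : Set (ℂ × ℂ) := symm '' {z | ‖z.1‖ = 1 ∧ ‖z.2‖ = 1}

/-! ## Polynomials in two variables -/

/-- The value `q(s, p)` of a polynomial in two variables at a point of `ℂ²`. -/
def evalPoint (q : MvPolynomial (Fin 2) ℂ) (z : ℂ × ℂ) : ℂ :=
  MvPolynomial.eval ![z.1, z.2] q

/-- The zero set `Z(q) ⊆ ℂ²`. -/
def zeroSet (q : MvPolynomial (Fin 2) ℂ) : Set (ℂ × ℂ) := {z | evalPoint q z = 0}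

/-- `q` is a `Γ`-distinguished polynomial: `Z(q)` meets `𝔾₂`, and it meets the topological
boundary of `Γ` in points of the distinguished boundary only. -/
def IsGammaDistinguishedPoly (q : MvPolynomial (Fin 2) ℂ) : Prop :=
  (zeroSet q ∩ openSymmBidisc).Nonempty ∧
    zeroSet q ∩ frontier closedSymmBidisc = zeroSet q ∩ distBoundary

section Operators

variable {H : Type u} [NormedAddCommGroup H] [InnerProductSpace ℂ H]

/-- The operator `q(S, P) = ∑ q_{ij} Sⁱ Pʲ` (used for commuting `S`, `P`). -/
def evalPair (q : MvPolynomial (Fin 2) ℂ) (S P : H →L[ℂ] H) : H →L[ℂ] H :=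
  ∑ m ∈ q.support, q.coeff m • (S ^ m 0 * P ^ m 1)

/-- Exactness of the Koszul complex
`0 → H → H ⊕ H → H → 0`, `x ↦ (A x, B x)`, `(x, y) ↦ A y - B x`,
of a commuting pair `(A, B)`, at each of its three places. -/
def KoszulExact (A B : H →L[ℂ] H) : Prop :=
  (∀ x : H, A x = 0 → B x = 0 → x = 0) ∧
  (∀ x y : H, A y - B x = 0 → ∃ w : H, A w = x ∧ B w = y) ∧
  (∀ z : H, ∃ x y : H, A y - B x = z)

/-- The Taylor joint spectrum `σ_T(S, P)` of a commuting pair. -/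
def taylorSpectrum (S P : H →L[ℂ] H) : Set (ℂ × ℂ) :=
  {z | ¬ KoszulExact (S - z.1 • (1 : H →L[ℂ] H)) (P - z.2 • (1 : H →L[ℂ] H))}

/-- `(S, P)` is a `Γ`-contraction: a commuting pair having `Γ` as a spectral set, i.e.
`σ_T(S, P) ⊆ Γ` and `‖f(S, P)‖ ≤ sup_Γ |f|` for every rational `f = g / q` whose denominator has
no zero in `Γ`. Then `f(S, P) = g(S, P) q(S, P)⁻¹`, where `q(S, P)` is invertible by the spectral
mapping theorem. The bound by the supremum is stated as the bound by every upper bound `C` of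
`|f|` on `Γ`. -/
def IsGammaContraction (S P : H →L[ℂ] H) : Prop :=
  Commute S P ∧ taylorSpectrum S P ⊆ closedSymmBidisc ∧
    ∀ g q : MvPolynomial (Fin 2) ℂ, (∀ z ∈ closedSymmBidisc, evalPoint q z ≠ 0) →
      ∀ C : ℝ, (∀ z ∈ closedSymmBidisc, ‖evalPoint g z / evalPoint q z‖ ≤ C) →
        ‖evalPair g S P * Ring.inverse (evalPair q S P)‖ ≤ C

/-- `(S, P)` is `Γ`-distinguished: a `Γ`-contraction annihilated by a `Γ`-distinguished
polynomial. -/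
def IsGammaDistinguished (S P : H →L[ℂ] H) : Prop :=
  IsGammaContraction S P ∧
    ∃ q : MvPolynomial (Fin 2) ℂ, IsGammaDistinguishedPoly q ∧ evalPair q S P = 0

variable [CompleteSpace H]

/-- `(S, P)` is a `Γ`-unitary: commuting normal operators with `σ_T(S, P) ⊆ bΓ`. -/
def IsGammaUnitary (S P : H →L[ℂ] H) : Prop :=
  Commute S P ∧ IsStarNormal S ∧ IsStarNormal P ∧ taylorSpectrum S P ⊆ distBoundary

/-- `(S, P)` is a `Γ`-isometry: the restriction of a `Γ`-unitary `(S', P')` on a Hilbert space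
`K` to a joint invariant subspace, the inclusion `H ⊆ K` being the isometry `V`. -/
def IsGammaIsometry (S P : H →L[ℂ] H) : Prop :=
  ∃ (K : Type u) (_ : NormedAddCommGroup K) (_ : InnerProductSpace ℂ K) (_ : CompleteSpace K)
    (V : H →ₗᵢ[ℂ] K) (S' P' : K →L[ℂ] K),
    IsGammaUnitary S' P' ∧ ∀ x : H, S' (V x) = V (S x) ∧ P' (V x) = V (P x)

/-- `P` is a pure contraction: `‖P‖ ≤ 1` and `P*ⁿ → 0` strongly. -/
def IsPureContraction (P : H →L[ℂ] H) : Prop :=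
  ‖P‖ ≤ 1 ∧
    ∀ x : H, Tendsto (fun n : ℕ => (ContinuousLinearMap.adjoint P ^ n) x) atTop (𝓝 0)

/-- `(S, P)` is a pure `Γ`-isometry. -/
def IsPureGammaIsometry (S P : H →L[ℂ] H) : Prop :=
  IsGammaIsometry S P ∧ IsPureContraction P

/-- The defect operator `D_P = (I - P*P)^{1/2}` of a contraction. -/
def defectOp (P : H →L[ℂ] H) : H →L[ℂ] H :=
  CFC.sqrt (1 - ContinuousLinearMap.adjoint P * P)

/-- The defect space `𝒟_P`, the closure of the range of `D_P`. -/
def defectSpace (P : H →L[ℂ] H) : Submodule ℂ H :=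
  (LinearMap.range (defectOp P).toLinearMap).topologicalClosure

/-- `D_P` as an operator from `H` into `𝒟_P`. -/
def defectMap (P : H →L[ℂ] H) : H →L[ℂ] defectSpace P :=
  (defectOp P).codRestrict (defectSpace P)
    fun x => Submodule.le_topologicalClosure _ ⟨x, rfl⟩

/-- `A ∈ B(𝒟_P)` is the fundamental operator of `(S, P)`: it solves `S - S*P = D_P A D_P`.
The solution in `B(𝒟_P)` is unique, because `D_P` is injective on `𝒟_P` and maps `H` onto a dense
subspace of it; so the bound `1` for its numerical radius need not be required here. -/
def IsFundamentalOperator (S P : H →L[ℂ] H) (A : defectSpace P →L[ℂ] defectSpace P) : Prop :=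
  S - ContinuousLinearMap.adjoint S * P =
    defectOp P ∘L (defectSpace P).subtypeL ∘L A ∘L defectMap P

end Operators

end GammaPair

end

namespace GammaPair

/-! ## Geometry of the symmetrized bidisc -/

/-! On `bΓ` one has `|p| = 1` and `conj s * p = s`. Gelfand theory turns these into identities for a
`Γ`-unitary, and they pass to restrictions, so a `Γ`-isometry satisfies `P* P = 1` and `S* P = S`,
hence `S* = P* S`. Then `D_{P*} = 1 - P P*` is the projection onto `ker P*`, and `F_*` is simply
`S*` restricted to `ker P*`. Everything follows from this description.

2 → 1: `(F_*, 0)` is the restriction of `(S*, P*)`, so it is annihilated by the coefficientwise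
conjugate of a polynomial annihilating `(S, P)`.

1 → 3: the eigenvalues of `F_*` lie in the closed disc. A unimodular eigenvalue `c` would put `(c,
0)` in `Z(q) ∩ ∂Γ`, yet points of `bΓ` have `|p| = 1`.

3 → 2: on `ker P*` one has `S = F_*^* + P F_*`, so a Cayley–Hamilton argument shows that `det (s -
F_*^* - p F_*)` annihilates `ker P*` (`evalPair_det_pencilMatrix_apply`). It commutes with the pure
isometry `P`, so it vanishes on all of `H` (`eq_zero_of_commute_of_pure`). At a zero `(z₁ + z₂, z₁
z₂)` with `|z₁| = 1` and `|z₂| < 1`, the bound 1 on the numerical radius of `F_*`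
(`IsGammaIsometry.norm_inner_star_le`) forces `conj z₁` to be an eigenvalue of `F_*`
(`apply_eq_smul_of_pencil`), against `r(F_*) < 1`.

Spectral mapping for the Taylor spectrum is avoided: `Γ` is described by the inequalities `|z₁ⁿ +
z₂ⁿ| ≤ 2`, which can be tested on the characters of a commutative Banach algebra. -/

lemma symm_swap (w : ℂ × ℂ) : symm w.swap = symm w := by
  simp [symm, add_comm, mul_comm]

lemma exists_symm_eq (z : ℂ × ℂ) : ∃ w, symm w = z := by
  obtain ⟨d, hd⟩ := IsAlgClosed.exists_pow_nat_eq (z.1 ^ 2 - 4 * z.2) (n := 2) (by norm_num)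
  refine ⟨((z.1 + d) / 2, (z.1 - d) / 2), ?_⟩
  ext
  · simp only [symm]; ring
  · simp only [symm]; linear_combination (-1 / 4 : ℂ) * hd

lemma eq_or_eq_swap_of_symm_eq {z w : ℂ × ℂ} (h : symm z = symm w) : z = w ∨ z = w.swap := by
  obtain ⟨h1, h2⟩ := Prod.ext_iff.1 h
  simp only [symm] at h1 h2
  have h3 : (z.1 - w.1) * (z.1 - w.2) = 0 := by linear_combination z.1 * h1 - h2
  rcases mul_eq_zero.1 h3 with h4 | h4
  · left
    ext
    · linear_combination h4
    · linear_combination h1 - h4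
  · right
    ext
    · simp only [Prod.fst_swap]; linear_combination h4
    · simp only [Prod.snd_swap]; linear_combination h1 - h4

lemma symm_mem_closedSymmBidisc_iff {w : ℂ × ℂ} :
    symm w ∈ closedSymmBidisc ↔ ‖w.1‖ ≤ 1 ∧ ‖w.2‖ ≤ 1 := by
  refine ⟨?_, fun h => ⟨w, h, rfl⟩⟩
  rintro ⟨v, ⟨h1, h2⟩, hv⟩
  rcases eq_or_eq_swap_of_symm_eq hv with rfl | rfl
  · exact ⟨h1, h2⟩
  · exact ⟨h2, h1⟩

lemma continuous_symm : Continuous symm := by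
  unfold symm; fun_prop

lemma isClosed_closedSymmBidisc : IsClosed closedSymmBidisc := by
  have : {z : ℂ × ℂ | ‖z.1‖ ≤ 1 ∧ ‖z.2‖ ≤ 1} =
      Metric.closedBall (0 : ℂ) 1 ×ˢ Metric.closedBall (0 : ℂ) 1 := by
    ext; simp
  rw [closedSymmBidisc, this]
  exact (((isCompact_closedBall _ _).prod (isCompact_closedBall _ _)).image
    continuous_symm).isClosed

lemma symm_mem_frontier {w : ℂ × ℂ} (h1 : ‖w.1‖ = 1) (h2 : ‖w.2‖ ≤ 1) :
    symm w ∈ frontier closedSymmBidisc := by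
  rw [isClosed_closedSymmBidisc.frontier_eq]
  refine ⟨symm_mem_closedSymmBidisc_iff.2 ⟨h1.le, h2⟩, fun hint => ?_⟩
  -- Dilating the roots by `t > 1` leaves `Γ`, because the first root then has modulus `t`.
  have hc : Tendsto (fun t : ℝ => symm ((t : ℂ) * w.1, (t : ℂ) * w.2)) (𝓝[>] 1) (𝓝 (symm w)) := by
    have : Continuous fun t : ℝ => symm ((t : ℂ) * w.1, (t : ℂ) * w.2) := by
      unfold symm; fun_prop
    simpa using (this.tendsto 1).mono_left nhdsWithin_le_nhds
  obtain ⟨t, ht, ht1⟩ := ((hc.eventually (mem_interior_iff_mem_nhds.1 hint)).and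
    self_mem_nhdsWithin).exists
  have := (symm_mem_closedSymmBidisc_iff.1 ht).1
  rw [norm_mul, h1, mul_one, Complex.norm_real, Real.norm_eq_abs] at this
  exact absurd ((le_abs_self t).trans this) (not_le.2 ht1)

/-- Continuity of the roots of a quadratic: `(z₁ - w₁)(z₁ - w₂)` is the quadratic with roots `w`
evaluated at a root of a nearby quadratic, so one factor is small. The sum of the roots then
controls the other one, at the cost of a second `δ`. -/
lemma exists_near_root {z w : ℂ × ℂ} {δ : ℝ} (hδ : 0 < δ)
    (hs : ‖(symm w).1 - (symm z).1‖ < δ)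
    (hp : ‖(symm w).1 - (symm z).1‖ * ‖z.1‖ + ‖(symm w).2 - (symm z).2‖ < δ ^ 2) :
    ∃ v, symm v = symm w ∧ ‖v.1 - z.1‖ < δ ∧ ‖v.2 - z.2‖ < 2 * δ := by
  have key : ‖z.1 - w.1‖ * ‖z.1 - w.2‖ < δ ^ 2 := by
    rw [← norm_mul]
    have : (z.1 - w.1) * (z.1 - w.2) =
        -(((symm w).1 - (symm z).1) * z.1) + ((symm w).2 - (symm z).2) := by
      simp only [symm]; ring
    rw [this]
    refine (norm_add_le _ _).trans_lt ?_
    rwa [norm_neg, norm_mul]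
  have main : ∀ v : ℂ × ℂ, symm v = symm w → ‖z.1 - v.1‖ < δ →
      ∃ v, symm v = symm w ∧ ‖v.1 - z.1‖ < δ ∧ ‖v.2 - z.2‖ < 2 * δ := by
    intro v hv h1
    refine ⟨v, hv, by rwa [norm_sub_rev], ?_⟩
    rw [← hv] at hs
    have : v.2 - z.2 = ((symm v).1 - (symm z).1) + (z.1 - v.1) := by
      simp only [symm]; ring
    rw [this]
    refine (norm_add_le _ _).trans_lt (by linarith)
  by_cases h : ‖z.1 - w.1‖ < δ
  · exact main w rfl h
  · refine main w.swap (symm_swap w) ?_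
    by_contra h'
    push Not at h h'
    simp only [Prod.fst_swap] at h'
    nlinarith [mul_le_mul h h' hδ.le (norm_nonneg _)]

lemma isOpen_openSymmBidisc : IsOpen openSymmBidisc := by
  rw [isOpen_iff_mem_nhds]
  rintro _ ⟨z, ⟨h1, h2⟩, rfl⟩
  obtain ⟨δ, hδ, hδ1, hδ2⟩ : ∃ δ : ℝ, 0 < δ ∧ ‖z.1‖ + δ ≤ 1 ∧ ‖z.2‖ + 2 * δ ≤ 1 := by
    refine ⟨min (1 - ‖z.1‖) ((1 - ‖z.2‖) / 2), lt_min (by linarith) (by linarith), ?_, ?_⟩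
    · linarith [min_le_left (1 - ‖z.1‖) ((1 - ‖z.2‖) / 2)]
    · linarith [min_le_right (1 - ‖z.1‖) ((1 - ‖z.2‖) / 2)]
  have e1 : ∀ᶠ y : ℂ × ℂ in 𝓝 (symm z), ‖y.1 - (symm z).1‖ < δ := by
    have : Continuous fun y : ℂ × ℂ => ‖y.1 - (symm z).1‖ := by fun_prop
    exact (this.tendsto (symm z)).eventually_lt_const (by simpa using hδ)
  have e2 : ∀ᶠ y : ℂ × ℂ in 𝓝 (symm z),
      ‖y.1 - (symm z).1‖ * ‖z.1‖ + ‖y.2 - (symm z).2‖ < δ ^ 2 := by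
    have : Continuous fun y : ℂ × ℂ =>
      ‖y.1 - (symm z).1‖ * ‖z.1‖ + ‖y.2 - (symm z).2‖ := by fun_prop
    exact (this.tendsto (symm z)).eventually_lt_const (by simpa using pow_pos hδ 2)
  filter_upwards [e1, e2] with y hy1 hy2
  obtain ⟨w, rfl⟩ := exists_symm_eq y
  obtain ⟨v, hv, hv1, hv2⟩ := exists_near_root hδ hy1 hy2
  refine ⟨v, ⟨?_, ?_⟩, hv⟩
  · linarith [norm_sub_norm_le v.1 z.1]
  · linarith [norm_sub_norm_le v.2 z.2]

lemma exists_of_mem_frontier {z : ℂ × ℂ} (hz : z ∈ frontier closedSymmBidisc) :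
    ∃ w : ℂ × ℂ, ‖w.1‖ = 1 ∧ ‖w.2‖ ≤ 1 ∧ symm w = z := by
  rw [isClosed_closedSymmBidisc.frontier_eq] at hz
  obtain ⟨⟨w, ⟨h1, h2⟩, rfl⟩, hint⟩ := hz
  rcases h1.lt_or_eq with h1' | h1'
  · rcases h2.lt_or_eq with h2' | h2'
    · refine absurd (interior_maximal ?_ isOpen_openSymmBidisc ⟨w, ⟨h1', h2'⟩, rfl⟩) hint
      rintro _ ⟨v, ⟨h1, h2⟩, rfl⟩
      exact ⟨v, ⟨h1.le, h2.le⟩, rfl⟩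
    · exact ⟨w.swap, h2', h1, symm_swap w⟩
  · exact ⟨w, h1', h2, rfl⟩

lemma distBoundary_subset_frontier : distBoundary ⊆ frontier closedSymmBidisc := by
  rintro _ ⟨w, ⟨h1, h2⟩, rfl⟩
  exact symm_mem_frontier h1 h2.le

lemma distBoundary_subset_closedSymmBidisc : distBoundary ⊆ closedSymmBidisc := by
  rintro _ ⟨w, ⟨h1, h2⟩, rfl⟩
  exact ⟨w, ⟨h1.le, h2.le⟩, rfl⟩

lemma norm_snd_of_mem_distBoundary {z : ℂ × ℂ} (hz : z ∈ distBoundary) : ‖z.2‖ = 1 := by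
  obtain ⟨w, ⟨h1, h2⟩, rfl⟩ := hz
  simp [symm, h1, h2]

lemma star_fst_mul_snd_of_mem_distBoundary {z : ℂ × ℂ} (hz : z ∈ distBoundary) :
    star z.1 * z.2 = z.1 := by
  obtain ⟨w, ⟨h1, h2⟩, rfl⟩ := hz
  have e1 : (starRingEnd ℂ) w.1 * w.1 = 1 := by
    rw [Complex.conj_mul', h1]; norm_num
  have e2 : (starRingEnd ℂ) w.2 * w.2 = 1 := by
    rw [Complex.conj_mul', h2]; norm_num
  simp only [symm, Complex.star_def, map_add]
  linear_combination w.2 * e1 + w.1 * e2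

lemma star_mem_closedSymmBidisc {z : ℂ × ℂ} (hz : z ∈ closedSymmBidisc) :
    star z ∈ closedSymmBidisc := by
  obtain ⟨w, ⟨h1, h2⟩, rfl⟩ := hz
  refine ⟨star w, ⟨by simpa using h1, by simpa using h2⟩, ?_⟩
  ext <;> simp [symm]

lemma zero_mem_closedSymmBidisc : (0 : ℂ × ℂ) ∈ closedSymmBidisc :=
  ⟨0, by simp, by ext <;> simp [symm]⟩

lemma norm_fst_le_one_of_mem {s : ℂ} (h : (s, (0 : ℂ)) ∈ closedSymmBidisc) : ‖s‖ ≤ 1 := by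
  have : symm (s, 0) = (s, 0) := by simp [symm]
  rw [← this, symm_mem_closedSymmBidisc_iff] at h
  exact h.1

/-! ## Power sums -/

/-- The polynomial `uₙ` with `uₙ(z₁ + z₂, z₁ z₂) = z₁ⁿ + z₂ⁿ`. -/
noncomputable def powerSum : ℕ → MvPolynomial (Fin 2) ℂ
  | 0 => 2
  | 1 => MvPolynomial.X 0
  | n + 2 => MvPolynomial.X 0 * powerSum (n + 1) - MvPolynomial.X 1 * powerSum n

lemma evalPoint_powerSum (w : ℂ × ℂ) (n : ℕ) :
    evalPoint (powerSum n) (symm w) = w.1 ^ n + w.2 ^ n := by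
  induction n using Nat.twoStepInduction with
  | zero => simp [powerSum, evalPoint]; norm_num
  | one => simp [powerSum, evalPoint, symm]
  | more n h1 h2 =>
    simp only [evalPoint] at h1 h2
    simp only [evalPoint, powerSum, map_sub, map_mul, h1, h2, MvPolynomial.eval_X,
      Matrix.cons_val_zero, Matrix.cons_val_one]
    simp only [symm]
    ring

lemma norm_evalPoint_powerSum_le {z : ℂ × ℂ} (hz : z ∈ closedSymmBidisc) (n : ℕ) :
    ‖evalPoint (powerSum n) z‖ ≤ 2 := by
  obtain ⟨w, ⟨h1, h2⟩, rfl⟩ := hz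
  rw [evalPoint_powerSum]
  refine (norm_add_le _ _).trans ?_
  rw [norm_pow, norm_pow]
  linarith [pow_le_one₀ (n := n) (norm_nonneg _) h1, pow_le_one₀ (n := n) (norm_nonneg _) h2]

lemma le_one_of_pow_le {r C : ℝ} (h : ∀ n : ℕ, r ^ n ≤ C) : r ≤ 1 := by
  by_contra! hr
  obtain ⟨n, hn⟩ := pow_unbounded_of_one_lt C hr
  exact absurd (h n) (not_le.2 hn)

/-- `Γ` is cut out by the power sums; in particular it is polynomially convex. -/
lemma mem_closedSymmBidisc_of_powerSum {z : ℂ × ℂ}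
    (h : ∀ n, ‖evalPoint (powerSum n) z‖ ≤ 2) : z ∈ closedSymmBidisc := by
  obtain ⟨w, rfl⟩ := exists_symm_eq z
  simp only [evalPoint_powerSum] at h
  -- Twice the `n`-th power of `w₁ w₂` is a squared power sum minus a power sum, so its modulus is
  -- at most `4 + 2`; this gives the constant 3.
  have hprod : ‖w.1‖ * ‖w.2‖ ≤ 1 := by
    refine le_one_of_pow_le (C := 3) fun n => ?_
    have e : 2 * (w.1 ^ n * w.2 ^ n) =
        (w.1 ^ n + w.2 ^ n) ^ 2 - (w.1 ^ (2 * n) + w.2 ^ (2 * n)) := by ring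
    have e' := congrArg norm e
    have h4 : ‖(w.1 ^ n + w.2 ^ n) ^ 2‖ ≤ 4 := by
      rw [norm_pow]; nlinarith [h n, norm_nonneg (w.1 ^ n + w.2 ^ n)]
    rw [norm_mul, norm_mul, norm_pow, norm_pow, ← mul_pow] at e'
    have := norm_sub_le ((w.1 ^ n + w.2 ^ n) ^ 2) (w.1 ^ (2 * n) + w.2 ^ (2 * n))
    have h2 : ‖(2 : ℂ)‖ = 2 := by norm_num
    rw [h2] at e'
    linarith [h (2 * n)]
  have main : ∀ a b : ℂ, ‖a‖ * ‖b‖ ≤ 1 → (∀ n : ℕ, ‖a ^ n + b ^ n‖ ≤ 2) → ‖a‖ ≤ 1 := by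
    intro a b hab hn
    by_contra! ha
    have hb : ‖b‖ ≤ 1 := by nlinarith [norm_nonneg b]
    refine absurd (le_one_of_pow_le (C := 3) fun n => ?_) (not_le.2 ha)
    have := norm_sub_norm_le (a ^ n) (-b ^ n)
    rw [norm_neg, sub_neg_eq_add, norm_pow, norm_pow] at this
    linarith [hn n, pow_le_one₀ (n := n) (norm_nonneg _) hb]
  refine symm_mem_closedSymmBidisc_iff.2 ⟨main _ _ hprod h, main _ _ (by rwa [mul_comm]) ?_⟩
  intro n
  rw [add_comm]
  exact h n

/-! ## Polynomial calculus of a commuting pair -/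

section Calculus

variable {H : Type u} [NormedAddCommGroup H] [InnerProductSpace ℂ H]
variable {K : Type*} [NormedAddCommGroup K] [InnerProductSpace ℂ K]

/-- Brings the raw sum defining `evalPair` into a commutative algebra, where it is the ring
homomorphism `aeval`; its multiplicativity for commuting pairs comes from here. -/
lemma evalPair_algHom {A : Type*} [CommRing A] [Algebra ℂ A] (φ : A →ₐ[ℂ] (H →L[ℂ] H)) (a b : A)
    (q : MvPolynomial (Fin 2) ℂ) :
    evalPair q (φ a) (φ b) = φ (MvPolynomial.aeval ![a, b] q) := by
  rw [MvPolynomial.aeval_def, MvPolynomial.eval₂_eq', map_sum]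
  simp [evalPair, Fin.prod_univ_two, Algebra.smul_def]

lemma map_aeval_pair {A : Type*} [CommRing A] [Algebra ℂ A] {F : Type*} [FunLike F A ℂ]
    [AlgHomClass F ℂ A ℂ] (χ : F) (a b : A) (q : MvPolynomial (Fin 2) ℂ) :
    χ (MvPolynomial.aeval ![a, b] q) = evalPoint q (χ a, χ b) := by
  rw [evalPoint, MvPolynomial.aeval_def, MvPolynomial.eval₂_eq', map_sum, MvPolynomial.eval_eq']
  refine Finset.sum_congr rfl fun m _ => ?_
  rw [map_mul, AlgHomClass.commutes]
  simp [Fin.prod_univ_two]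

/-- Intertwining of pairs passes to polynomials. -/
lemma evalPair_intertwine {S P : H →L[ℂ] H} {S' P' : K →L[ℂ] K} {V : H →L[ℂ] K}
    (hS : S' ∘L V = V ∘L S) (hP : P' ∘L V = V ∘L P) (q : MvPolynomial (Fin 2) ℂ) :
    evalPair q S' P' ∘L V = V ∘L evalPair q S P := by
  have hpow : ∀ {T : H →L[ℂ] H} {T' : K →L[ℂ] K}, T' ∘L V = V ∘L T →
      ∀ (n : ℕ) (x : H), (T' ^ n) (V x) = V ((T ^ n) x) := by
    intro T T' h n
    induction n with
    | zero => simp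
    | succ n ih =>
      intro x
      rw [pow_succ, pow_succ, mul_apply_eq_comp, mul_apply_eq_comp, ← ih]
      exact congrArg _ (DFunLike.congr_fun h x)
  ext x
  simp [evalPair, hpow hS, hpow hP]

/-- A commuting pair of operators lives in a commutative Banach algebra of operators. -/
lemma exists_commBanachAlgebra [CompleteSpace H] {S P : H →L[ℂ] H} (h : Commute S P) :
    ∃ (A : Type u) (_ : NormedCommRing A) (_ : NormedAlgebra ℂ A) (_ : CompleteSpace A)
      (φ : A →ₐ[ℂ] (H →L[ℂ] H)) (a b : A), φ a = S ∧ φ b = P ∧ ∀ x, ‖φ x‖ = ‖x‖ := by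
  have hc : IsMulCommutative (Algebra.adjoin ℂ {S, P}) := by
    refine Algebra.isMulCommutative_adjoin ℂ ?_
    rintro a (rfl | rfl) b (rfl | rfl)
    exacts [rfl, h, h.symm, rfl]
  let A := (Algebra.adjoin ℂ {S, P}).topologicalClosure
  have hA : ∀ x y : A, x * y = y * x :=
    (Subalgebra.commRingTopologicalClosure (Algebra.adjoin ℂ {S, P}) hc.is_comm.comm).mul_comm
  have hmem : ∀ T ∈ ({S, P} : Set (H →L[ℂ] H)), T ∈ A := fun T hT =>
    Subalgebra.le_topologicalClosure _ (Algebra.subset_adjoin hT)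
  let _ : NormedCommRing A := { (inferInstance : NormedRing A) with mul_comm := hA }
  exact ⟨A, inferInstance, inferInstance,
    (Subalgebra.isClosed_topologicalClosure _).completeSpace_coe, A.val,
    ⟨S, hmem S (by simp)⟩, ⟨P, hmem P (by simp)⟩, rfl, rfl, fun _ => rfl⟩

/-- A commuting pair of normal operators lives in a commutative C⋆-algebra of operators. -/
lemma exists_commCStarAlgebra [CompleteSpace H] {S P : H →L[ℂ] H} (h : Commute S P)
    (hS : IsStarNormal S) (hP : IsStarNormal P) :
    ∃ (A : Type u) (_ : CommCStarAlgebra A) (φ : A →⋆ₐ[ℂ] (H →L[ℂ] H)) (a b : A),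
      φ a = S ∧ φ b = P ∧ (∀ x, ‖φ x‖ = ‖x‖) ∧ ∀ x, IsUnit (φ x) → IsUnit x := by
  have hc : IsMulCommutative (StarAlgebra.adjoin ℂ {S, P}) := by
    refine StarAlgebra.isMulCommutative_adjoin ℂ ?_ ?_
    · rintro a (rfl | rfl) b (rfl | rfl)
      exacts [rfl, h, h.symm, rfl]
    · rintro a (rfl | rfl) b (rfl | rfl)
      -- The mixed cases are Fuglede's theorem: an operator commuting with a normal one commutes
      -- with its adjoint.
      exacts [hS.star_comm_self.symm, hP.commute_star_right h, hS.commute_star_right h.symm,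
        hP.star_comm_self.symm]
  let A := (StarAlgebra.adjoin ℂ {S, P}).topologicalClosure
  have hA : ∀ x y : A, x * y = y * x :=
    (StarSubalgebra.commRingTopologicalClosure (StarAlgebra.adjoin ℂ {S, P})
      hc.is_comm.comm).mul_comm
  have hmem : ∀ T ∈ ({S, P} : Set (H →L[ℂ] H)), T ∈ A := fun T hT =>
    StarSubalgebra.le_topologicalClosure _ (StarAlgebra.subset_adjoin ℂ _ hT)
  have hcl : IsClosed (A : Set (H →L[ℂ] H)) := StarSubalgebra.isClosed_topologicalClosure _
  let _ : CommCStarAlgebra A := { StarSubalgebra.cstarAlgebra A with mul_comm := hA }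
  exact ⟨A, inferInstance, A.subtype,
    ⟨S, hmem S (by simp)⟩, ⟨P, hmem P (by simp)⟩, rfl, rfl, fun _ => rfl,
    fun x hx => (StarSubalgebra.coe_isUnit A).1 hx⟩

lemma evalPair_commute [CompleteSpace H] {S P : H →L[ℂ] H} (h : Commute S P)
    (g q : MvPolynomial (Fin 2) ℂ) :
    Commute (evalPair g S P) (evalPair q S P) := by
  obtain ⟨A, _, _, _, φ, a, b, rfl, rfl, -⟩ := exists_commBanachAlgebra h
  rw [evalPair_algHom, evalPair_algHom]
  exact (Commute.all _ _).map φ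

lemma evalPair_mul [CompleteSpace H] {S P : H →L[ℂ] H} (h : Commute S P)
    (g q : MvPolynomial (Fin 2) ℂ) :
    evalPair (g * q) S P = evalPair g S P * evalPair q S P := by
  obtain ⟨A, _, _, _, φ, a, b, rfl, rfl, -⟩ := exists_commBanachAlgebra h
  simp only [evalPair_algHom, map_mul]

lemma evalPair_one [CompleteSpace H] {S P : H →L[ℂ] H} (h : Commute S P) :
    evalPair 1 S P = 1 := by
  obtain ⟨A, _, _, _, φ, a, b, rfl, rfl, -⟩ := exists_commBanachAlgebra h
  simp only [evalPair_algHom, map_one]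

lemma evalPair_X_zero [CompleteSpace H] {S P : H →L[ℂ] H} (h : Commute S P) :
    evalPair (MvPolynomial.X 0) S P = S := by
  obtain ⟨A, _, _, _, φ, a, b, rfl, rfl, -⟩ := exists_commBanachAlgebra h
  simp [evalPair_algHom]

lemma evalPair_X_one [CompleteSpace H] {S P : H →L[ℂ] H} (h : Commute S P) :
    evalPair (MvPolynomial.X 1) S P = P := by
  obtain ⟨A, _, _, _, φ, a, b, rfl, rfl, -⟩ := exists_commBanachAlgebra h
  simp [evalPair_algHom]

/-- The polynomial with conjugated coefficients. -/
noncomputable def conjPoly (q : MvPolynomial (Fin 2) ℂ) : MvPolynomial (Fin 2) ℂ :=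
  MvPolynomial.map (starRingEnd ℂ) q

lemma evalPoint_conjPoly (q : MvPolynomial (Fin 2) ℂ) (z : ℂ × ℂ) :
    evalPoint (conjPoly q) z = star (evalPoint q (star z)) := by
  rw [evalPoint, conjPoly, evalPoint, MvPolynomial.eval_map, MvPolynomial.eval₂_eq',
    MvPolynomial.eval_eq', star_sum]
  refine Finset.sum_congr rfl fun m _ => ?_
  simp [Fin.prod_univ_two]

lemma adjoint_evalPair [CompleteSpace H] {S P : H →L[ℂ] H} (h : Commute S P)
    (q : MvPolynomial (Fin 2) ℂ) :
    evalPair (conjPoly q) (star S) (star P) = star (evalPair q S P) := by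
  rw [evalPair, evalPair, star_sum, conjPoly,
    MvPolynomial.support_map_of_injective _ (starRingEnd ℂ).injective]
  refine Finset.sum_congr rfl fun m _ => ?_
  rw [MvPolynomial.coeff_map, star_smul, star_mul, star_pow, star_pow,
    ((h.star_star).pow_pow _ _).eq]
  rfl

/-- The power sum bounds put the characters into `Γ`. -/
lemma character_mem_closedSymmBidisc {A : Type*} [NormedCommRing A] [NormedAlgebra ℂ A]
    [CompleteSpace A] (h1 : ‖(1 : A)‖ ≤ 1) {a b : A}
    (h : ∀ n, ‖MvPolynomial.aeval ![a, b] (powerSum n)‖ ≤ 2)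
    (χ : WeakDual.characterSpace ℂ A) : (χ a, χ b) ∈ closedSymmBidisc := by
  refine mem_closedSymmBidisc_of_powerSum fun n => ?_
  rw [← map_aeval_pair χ]
  refine (AlgHom.norm_apply_le_self_mul_norm_one χ _).trans ?_
  nlinarith [h n, norm_nonneg (MvPolynomial.aeval ![a, b] (powerSum n)), norm_nonneg (1 : A)]

variable [CompleteSpace H]

/-- For `z` outside `Γ` no character takes the value `z` on the pair, so the two differences
generate the unit ideal. A relation `c a' + d b' = 1` is a contracting homotopy of the Koszul
complex. -/
lemma taylorSpectrum_subset_of_powerSum {S P : H →L[ℂ] H} (h : Commute S P)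
    (hn : ∀ n, ‖evalPair (powerSum n) S P‖ ≤ 2) : taylorSpectrum S P ⊆ closedSymmBidisc := by
  obtain ⟨A, _, _, _, φ, a, b, rfl, rfl, hφ⟩ := exists_commBanachAlgebra h
  -- Only an inequality, since `H` may be zero.
  have h1 : ‖(1 : A)‖ ≤ 1 := by
    rw [← hφ, map_one]; exact ContinuousLinearMap.norm_id_le
  simp only [evalPair_algHom, hφ] at hn
  intro z hz
  by_contra hzΓ
  apply hz
  have htop : Ideal.span {a - algebraMap ℂ A z.1, b - algebraMap ℂ A z.2} = ⊤ := by
    by_contra hne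
    obtain ⟨M, hM, hle⟩ := Ideal.exists_le_maximal _ hne
    have ha := M.toCharacterSpace_apply_eq_zero_of_mem (hle (Ideal.subset_span (Or.inl rfl)))
    have hb := M.toCharacterSpace_apply_eq_zero_of_mem (hle (Ideal.subset_span (Or.inr rfl)))
    rw [map_sub, AlgHomClass.commutes, sub_eq_zero] at ha hb
    have := character_mem_closedSymmBidisc h1 hn M.toCharacterSpace
    rw [ha, hb] at this
    exact hzΓ this
  obtain ⟨c, d, hcd⟩ := Ideal.mem_span_pair.1 ((Ideal.eq_top_iff_one _).1 htop)
  have ea : φ a - z.1 • (1 : H →L[ℂ] H) = φ (a - algebraMap ℂ A z.1) := by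
    rw [map_sub, AlgHom.commutes, Algebra.algebraMap_eq_smul_one]
  have eb : φ b - z.2 • (1 : H →L[ℂ] H) = φ (b - algebraMap ℂ A z.2) := by
    rw [map_sub, AlgHom.commutes, Algebra.algebraMap_eq_smul_one]
  rw [ea, eb]
  set a' := a - algebraMap ℂ A z.1
  set b' := b - algebraMap ℂ A z.2
  have mulapp : ∀ (x y : A) (v : H), φ x (φ y v) = φ (x * y) v := by
    intro x y v; rw [map_mul]; rfl
  have key : ∀ x : H, φ (a' * c) x + φ (b' * d) x = x := by
    intro x
    have : φ (a' * c + b' * d) = 1 := by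
      rw [mul_comm a', mul_comm b', hcd, map_one]
    calc _ = φ (a' * c + b' * d) x := by rw [map_add]; rfl
      _ = x := by rw [this]; rfl
  refine ⟨fun x hx hy => ?_, fun x y hxy => ?_, fun x => ?_⟩
  · rw [← key x, mul_comm a', mul_comm b', ← mulapp, ← mulapp, hx, hy]; simp
  · rw [sub_eq_zero] at hxy
    refine ⟨φ c x + φ d y, ?_, ?_⟩
    · rw [map_add, mulapp, mulapp, mul_comm a' d, ← mulapp d, hxy, mulapp, mul_comm d, key]
    · rw [map_add, mulapp, mulapp, mul_comm b' c, ← mulapp c, ← hxy, mulapp, mul_comm c, key]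
  · refine ⟨-φ d x, φ c x, ?_⟩
    rw [map_neg, sub_neg_eq_add, mulapp, mulapp, key]

/-- Makes every `Ring.inverse` in the definition of a `Γ`-contraction a true inverse, rather than
the default value 0. -/
lemma isUnit_evalPair_of_powerSum {S P : H →L[ℂ] H} (h : Commute S P)
    (hn : ∀ n, ‖evalPair (powerSum n) S P‖ ≤ 2) {q : MvPolynomial (Fin 2) ℂ}
    (hq : ∀ z ∈ closedSymmBidisc, evalPoint q z ≠ 0) : IsUnit (evalPair q S P) := by
  obtain ⟨A, _, _, _, φ, a, b, rfl, rfl, hφ⟩ := exists_commBanachAlgebra h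
  have h1 : ‖(1 : A)‖ ≤ 1 := by
    rw [← hφ, map_one]; exact ContinuousLinearMap.norm_id_le
  simp only [evalPair_algHom, hφ] at hn ⊢
  refine IsUnit.map φ ?_
  by_contra hu
  obtain ⟨χ, hχ⟩ := WeakDual.CharacterSpace.exists_apply_eq_zero hu
  rw [map_aeval_pair] at hχ
  exact hq _ (character_mem_closedSymmBidisc h1 hn χ) hχ

end Calculus

/-! ## `Γ`-contractions -/

section Contractions

variable {H : Type u} [NormedAddCommGroup H] [InnerProductSpace ℂ H] [CompleteSpace H]
variable {K : Type*} [NormedAddCommGroup K] [InnerProductSpace ℂ K] [CompleteSpace K]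

lemma IsGammaContraction.norm_evalPair_le {S P : H →L[ℂ] H} (h : IsGammaContraction S P)
    {g : MvPolynomial (Fin 2) ℂ} {C : ℝ} (hC : ∀ z ∈ closedSymmBidisc, ‖evalPoint g z‖ ≤ C) :
    ‖evalPair g S P‖ ≤ C := by
  have := h.2.2 g 1 (fun z _ => by simp [evalPoint]) C
    (fun z hz => by simpa [evalPoint] using hC z hz)
  rwa [evalPair_one h.1, Ring.inverse_one, mul_one] at this

lemma IsGammaContraction.norm_powerSum_le {S P : H →L[ℂ] H} (h : IsGammaContraction S P) (n : ℕ) :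
    ‖evalPair (powerSum n) S P‖ ≤ 2 :=
  h.norm_evalPair_le fun _ hz => norm_evalPoint_powerSum_le hz n

lemma IsGammaContraction.isUnit_evalPair {S P : H →L[ℂ] H} (h : IsGammaContraction S P)
    {q : MvPolynomial (Fin 2) ℂ} (hq : ∀ z ∈ closedSymmBidisc, evalPoint q z ≠ 0) :
    IsUnit (evalPair q S P) :=
  isUnit_evalPair_of_powerSum h.1 h.norm_powerSum_le hq

lemma IsGammaContraction.norm_fst_le {S P : H →L[ℂ] H} (h : IsGammaContraction S P) :
    ‖S‖ ≤ 2 := by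
  simpa [powerSum, evalPair_X_zero h.1] using h.norm_powerSum_le 1

omit [CompleteSpace H] [CompleteSpace K] in
lemma norm_le_of_isometry_intertwine {V : H →ₗᵢ[ℂ] K} {T : H →L[ℂ] H} {T' : K →L[ℂ] K}
    (h : T' ∘L V.toContinuousLinearMap = V.toContinuousLinearMap ∘L T) : ‖T‖ ≤ ‖T'‖ := by
  refine ContinuousLinearMap.opNorm_le_bound _ (norm_nonneg _) fun x => ?_
  have : T' (V x) = V (T x) := DFunLike.congr_fun h x
  rw [← V.norm_map (T x), ← this, ← V.norm_map x]
  exact T'.le_opNorm _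

/-- The restriction of a `Γ`-contraction to a joint invariant subspace is a `Γ`-contraction. -/
lemma IsGammaContraction.restrict {S P : H →L[ℂ] H} {S' P' : K →L[ℂ] K}
    (h : IsGammaContraction S' P') (V : H →ₗᵢ[ℂ] K)
    (hS : ∀ x, S' (V x) = V (S x)) (hP : ∀ x, P' (V x) = V (P x)) : IsGammaContraction S P := by
  have hS' : S' ∘L V.toContinuousLinearMap = V.toContinuousLinearMap ∘L S :=
    ContinuousLinearMap.ext hS
  have hP' : P' ∘L V.toContinuousLinearMap = V.toContinuousLinearMap ∘L P :=
    ContinuousLinearMap.ext hP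
  have hc : Commute S P := by
    refine ContinuousLinearMap.ext fun x => V.injective ?_
    change V (S (P x)) = V (P (S x))
    rw [← hS, ← hP, ← hP, ← hS]
    exact DFunLike.congr_fun h.1.eq (V x)
  have hn : ∀ n, ‖evalPair (powerSum n) S P‖ ≤ 2 := fun n =>
    (norm_le_of_isometry_intertwine (evalPair_intertwine hS' hP' _)).trans (h.norm_powerSum_le n)
  refine ⟨hc, taylorSpectrum_subset_of_powerSum hc hn, fun g q hq C hC => ?_⟩
  refine (norm_le_of_isometry_intertwine (V := V)
    (T' := evalPair g S' P' * Ring.inverse (evalPair q S' P')) ?_).trans (h.2.2 g q hq C hC)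
  -- Invertibility does not in general pass to invariant subspaces. Here it follows from the power
  -- sum bounds, which do; then `V` intertwines the inverses.
  obtain ⟨u, hu⟩ := isUnit_evalPair_of_powerSum hc hn hq
  obtain ⟨u', hu'⟩ := h.isUnit_evalPair hq
  rw [← hu, ← hu', Ring.inverse_unit, Ring.inverse_unit]
  have hg := evalPair_intertwine hS' hP' g
  have hqi := evalPair_intertwine hS' hP' q
  rw [← hu, ← hu'] at hqi
  ext x
  have e1 : (u : H →L[ℂ] H) ((u⁻¹ : (H →L[ℂ] H)ˣ).val x) = x :=
    DFunLike.congr_fun (u.mul_inv) x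
  have e2 : ∀ y, (u'⁻¹ : (K →L[ℂ] K)ˣ).val ((u' : K →L[ℂ] K) y) = y :=
    DFunLike.congr_fun (u'.inv_mul)
  have e3 : (u'⁻¹ : (K →L[ℂ] K)ˣ).val (V x) = V ((u⁻¹ : (H →L[ℂ] H)ˣ).val x) := by
    conv_lhs => rw [← e1]
    rw [← e2 (V ((u⁻¹ : (H →L[ℂ] H)ˣ).val x))]
    exact congrArg _ (DFunLike.congr_fun hqi _).symm
  change evalPair g S' P' ((u'⁻¹ : (K →L[ℂ] K)ˣ).val (V x)) = V (evalPair g S P _)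
  rw [e3]
  exact DFunLike.congr_fun hg _

lemma IsGammaContraction.adjoint {S P : H →L[ℂ] H} (h : IsGammaContraction S P) :
    IsGammaContraction (star S) (star P) := by
  have hconj : ∀ q, conjPoly (conjPoly q) = q := fun q => by
    rw [conjPoly, conjPoly, MvPolynomial.map_map]
    convert MvPolynomial.map_id q
    ext; simp
  have hev : ∀ q, evalPair q (star S) (star P) = star (evalPair (conjPoly q) S P) := fun q => by
    rw [← adjoint_evalPair h.1, hconj]
  have hc : Commute (star S) (star P) := h.1.star_star
  refine ⟨hc, taylorSpectrum_subset_of_powerSum hc fun n => ?_, fun g q hq C hC => ?_⟩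
  · rw [hev, norm_star]
    refine h.norm_evalPair_le fun z hz => ?_
    rw [evalPoint_conjPoly, norm_star]
    exact norm_evalPoint_powerSum_le (star_mem_closedSymmBidisc hz) n
  · have hq' : ∀ z ∈ closedSymmBidisc, evalPoint (conjPoly q) z ≠ 0 := fun z hz => by
      rw [evalPoint_conjPoly]
      exact star_ne_zero.2 (hq _ (star_mem_closedSymmBidisc hz))
    obtain ⟨u, hu⟩ := h.isUnit_evalPair hq'
    have hcomm := evalPair_commute h.1 (conjPoly g) (conjPoly q)
    rw [hev, hev, Ring.inverse_star, ← star_mul, norm_star]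
    rw [← hu] at hcomm
    have e : Ring.inverse (evalPair (conjPoly q) S P) * evalPair (conjPoly g) S P =
        evalPair (conjPoly g) S P * Ring.inverse (evalPair (conjPoly q) S P) := by
      rw [← hu, Ring.inverse_unit]
      exact hcomm.units_inv_right.symm.eq
    rw [e]
    refine h.2.2 _ _ hq' C fun z hz => ?_
    rw [evalPoint_conjPoly, evalPoint_conjPoly, ← star_div₀, norm_star]
    exact hC _ (star_mem_closedSymmBidisc hz)

/-- The joint characters of a commuting pair of normal operators lie in the Taylor spectrum. -/
lemma character_mem_taylorSpectrum {A : Type*} [CommCStarAlgebra A]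
    (φ : A →⋆ₐ[ℂ] (H →L[ℂ] H)) (hφ : ∀ x, IsUnit (φ x) → IsUnit x) (a b : A)
    (χ : WeakDual.characterSpace ℂ A) : (χ a, χ b) ∈ taylorSpectrum (φ a) (φ b) := by
  intro hex
  obtain ⟨-, -, hsurj⟩ := hex
  set a' := a - algebraMap ℂ A (χ a) with ha'
  set b' := b - algebraMap ℂ A (χ b) with hb'
  have ea : φ a - χ a • (1 : H →L[ℂ] H) = φ a' := by
    rw [ha', map_sub, AlgHomClass.commutes, Algebra.algebraMap_eq_smul_one]
  have eb : φ b - χ b • (1 : H →L[ℂ] H) = φ b' := by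
    rw [hb', map_sub, AlgHomClass.commutes, Algebra.algebraMap_eq_smul_one]
  simp only [ea, eb] at hsurj
  have hχ : χ (a' * star a' + b' * star b') = 0 := by
    simp [ha', hb', AlgHomClass.commutes]
  have hnu : ¬ IsUnit (a' * star a' + b' * star b') := fun hu => by
    have := hu.map χ
    rw [hχ] at this
    exact not_isUnit_zero this
  apply hnu
  apply hφ
  -- Only surjectivity of the last Koszul map is used. The open mapping constant `c` gives `‖z‖² ≤
  -- 2c² (‖a'* z‖² + ‖b'* z‖²)`, so `a' a'* + b' b'*` is bounded below and invertible, although `χ`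
  -- kills it.
  let R : H × H →L[ℂ] H := (φ a').comp (ContinuousLinearMap.snd ℂ H H) -
    (φ b').comp (ContinuousLinearMap.fst ℂ H H)
  have hR : Function.Surjective R := fun z => by
    obtain ⟨x, y, h⟩ := hsurj z
    exact ⟨(x, y), h⟩
  obtain ⟨c, hc, hcR⟩ := R.exists_preimage_norm_le hR
  have hT : ∀ z : H, inner ℂ (φ (a' * star a' + b' * star b') z) z =
      ((‖φ (star a') z‖ ^ 2 + ‖φ (star b') z‖ ^ 2 : ℝ) : ℂ) := by
    intro z
    have : ∀ x : A, inner ℂ (φ (x * star x) z) z = ((‖φ (star x) z‖ ^ 2 : ℝ) : ℂ) := by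
      intro x
      rw [map_mul, map_star, mul_apply_eq_comp,
        ContinuousLinearMap.star_eq_adjoint, ← ContinuousLinearMap.adjoint_inner_right,
        inner_self_eq_norm_sq_to_K]
      push_cast; rfl
    rw [map_add, add_apply, inner_add_left, this, this]
    push_cast; rfl
  refine ContinuousLinearMap.isUnit_of_forall_le_norm_inner_map _
    (c := ((2 * c ^ 2)⁻¹).toNNReal) (Real.toNNReal_pos.2 (by positivity)) fun z => ?_
  rw [hT, Complex.norm_real, Real.norm_eq_abs, abs_of_nonneg (by positivity)]
  rw [Real.coe_toNNReal _ (by positivity)]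
  obtain ⟨⟨x, y⟩, hxy, hle⟩ := hcR z
  have hx : ‖x‖ ≤ c * ‖z‖ := (le_max_left _ _).trans hle
  have hy : ‖y‖ ≤ c * ‖z‖ := (le_max_right _ _).trans hle
  have hz : φ a' y - φ b' x = z := hxy
  have h1 : ‖z‖ ^ 2 ≤ c * ‖z‖ * (‖φ (star a') z‖ + ‖φ (star b') z‖) := by
    have e : ((‖z‖ ^ 2 : ℝ) : ℂ) = inner ℂ y (φ (star a') z) - inner ℂ x (φ (star b') z) := by
      rw [map_star, map_star, ContinuousLinearMap.star_eq_adjoint,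
        ContinuousLinearMap.star_eq_adjoint, ContinuousLinearMap.adjoint_inner_right,
        ContinuousLinearMap.adjoint_inner_right, ← inner_sub_left, hz, inner_self_eq_norm_sq_to_K]
      push_cast; rfl
    have e' := congrArg norm e
    rw [Complex.norm_real, Real.norm_eq_abs, abs_of_nonneg (by positivity)] at e'
    rw [e']
    refine (norm_sub_le _ _).trans ?_
    have i1 := norm_inner_le_norm (𝕜 := ℂ) y (φ (star a') z)
    have i2 := norm_inner_le_norm (𝕜 := ℂ) x (φ (star b') z)
    have j1 := mul_le_mul_of_nonneg_right hy (norm_nonneg (φ (star a') z))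
    have j2 := mul_le_mul_of_nonneg_right hx (norm_nonneg (φ (star b') z))
    linarith
  have h2 : ‖z‖ ≤ c * (‖φ (star a') z‖ + ‖φ (star b') z‖) := by
    rcases (norm_nonneg z).eq_or_lt with h0 | h0
    · rw [← h0]; positivity
    · refine le_of_mul_le_mul_left ?_ h0
      linarith
  rw [← div_eq_mul_inv, div_le_iff₀ (by positivity)]
  have h3 : ‖z‖ ^ 2 ≤ (c * (‖φ (star a') z‖ + ‖φ (star b') z‖)) ^ 2 :=
    pow_le_pow_left₀ (norm_nonneg _) h2 2
  nlinarith [mul_nonneg (sq_nonneg c) (sq_nonneg (‖φ (star a') z‖ - ‖φ (star b') z‖))]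

lemma norm_le_of_forall_character {A : Type*} [CommCStarAlgebra A] {x : A} {C : ℝ} (hC : 0 ≤ C)
    (h : ∀ χ : WeakDual.characterSpace ℂ A, ‖χ x‖ ≤ C) : ‖x‖ ≤ C := by
  rw [← (AddMonoidHomClass.isometry_iff_norm _).1 (gelfandTransform_isometry A) x,
    ContinuousMap.norm_le _ hC]
  exact h

/-- By Gelfand–Naimark the norm of `f(S, P)` is the supremum of `|f|` over the joint characters, all
of which lie in `bΓ`. -/
lemma IsGammaUnitary.isGammaContraction {S P : H →L[ℂ] H} (h : IsGammaUnitary S P) :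
    IsGammaContraction S P := by
  obtain ⟨hc, hS, hP, hσ⟩ := h
  obtain ⟨A, _, φ, a, b, rfl, rfl, hφ, hu⟩ := exists_commCStarAlgebra hc hS hP
  have hχ : ∀ χ : WeakDual.characterSpace ℂ A, (χ a, χ b) ∈ closedSymmBidisc := fun χ =>
    distBoundary_subset_closedSymmBidisc (hσ (character_mem_taylorSpectrum φ hu a b χ))
  have hev : ∀ q, evalPair q (φ a) (φ b) = φ (MvPolynomial.aeval ![a, b] q) :=
    evalPair_algHom φ.toAlgHom a b
  refine ⟨hc, hσ.trans distBoundary_subset_closedSymmBidisc, fun g q hq C hC => ?_⟩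
  have hqu : IsUnit (MvPolynomial.aeval ![a, b] q) := by
    by_contra hu
    obtain ⟨χ, h0⟩ := WeakDual.CharacterSpace.exists_apply_eq_zero hu
    rw [map_aeval_pair] at h0
    exact hq _ (hχ χ) h0
  obtain ⟨v, hv⟩ := hqu
  have hinv : Ring.inverse (φ (v : A)) = φ (v⁻¹ : Aˣ).val :=
    Ring.inverse_unit (Units.map (φ : A →* (H →L[ℂ] H)) v)
  rw [hev, hev, ← hv, hinv, ← map_mul, hφ]
  refine norm_le_of_forall_character ((norm_nonneg _).trans (hC 0 zero_mem_closedSymmBidisc))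
    fun χ => ?_
  have hχv : χ (v⁻¹ : Aˣ).val = (χ (v : A))⁻¹ :=
    eq_inv_of_mul_eq_one_left (by rw [← map_mul, Units.inv_mul, map_one])
  rw [map_mul, hχv, hv, map_aeval_pair, map_aeval_pair, ← div_eq_mul_inv]
  exact hC _ (hχ χ)

lemma IsGammaUnitary.star_mul_self_snd {S P : H →L[ℂ] H} (h : IsGammaUnitary S P) :
    star P * P = 1 := by
  obtain ⟨hc, hS, hP, hσ⟩ := h
  obtain ⟨A, _, φ, a, b, rfl, rfl, hφ, hu⟩ := exists_commCStarAlgebra hc hS hP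
  have : star b * b - 1 = 0 := norm_le_zero_iff.1 <| norm_le_of_forall_character le_rfl fun χ => by
    have := norm_snd_of_mem_distBoundary (hσ (character_mem_taylorSpectrum φ hu a b χ))
    rw [norm_le_zero_iff, map_sub, map_mul, map_star, map_one, Complex.star_def,
      Complex.conj_mul', this]
    norm_num
  rw [← map_star, ← map_mul, sub_eq_zero.1 this, map_one]

lemma IsGammaUnitary.star_fst_mul_snd {S P : H →L[ℂ] H} (h : IsGammaUnitary S P) :
    star S * P = S := by
  obtain ⟨hc, hS, hP, hσ⟩ := h
  obtain ⟨A, _, φ, a, b, rfl, rfl, hφ, hu⟩ := exists_commCStarAlgebra hc hS hP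
  have : star a * b - a = 0 := norm_le_zero_iff.1 <| norm_le_of_forall_character le_rfl fun χ => by
    have := star_fst_mul_snd_of_mem_distBoundary (hσ (character_mem_taylorSpectrum φ hu a b χ))
    rw [norm_le_zero_iff, map_sub, map_mul, map_star, sub_eq_zero]
    exact this
  rw [← map_star, ← map_mul, sub_eq_zero.1 this]

end Contractions

/-! ## Numerical radius and eigenvectors -/

section Eigen

variable {E : Type*} [NormedAddCommGroup E] [InnerProductSpace ℂ E]

lemma mem_spectrum_of_apply_eq_smul {A : E →L[ℂ] E} {v : E} (hv : v ≠ 0) {c : ℂ}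
    (h : A v = c • v) : c ∈ spectrum ℂ A := by
  rintro ⟨u, hu⟩
  apply hv
  have h0 : (u : E →L[ℂ] E) v = 0 := by
    rw [hu, sub_apply, h, Algebra.algebraMap_eq_smul_one]; simp
  have h1 : (u⁻¹ : (E →L[ℂ] E)ˣ).val ((u : E →L[ℂ] E) v) = v := DFunLike.congr_fun u.inv_mul v
  rw [← h1, h0, map_zero]

lemma exists_apply_eq_smul_of_mem_spectrum [FiniteDimensional ℂ E] {A : E →L[ℂ] E} {c : ℂ}
    (h : c ∈ spectrum ℂ A) : ∃ v, v ≠ 0 ∧ A v = c • v := by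
  have := FiniteDimensional.complete ℂ E
  by_contra! hne
  apply h
  rw [spectrum.mem_resolventSet_iff, ContinuousLinearMap.isUnit_iff_bijective]
  have hinj : Function.Injective (algebraMap ℂ (E →L[ℂ] E) c - A) := by
    rw [injective_iff_map_eq_zero]
    intro v hv
    by_contra h0
    refine hne v h0 ?_
    rw [sub_apply, Algebra.algebraMap_eq_smul_one, sub_eq_zero] at hv
    simpa using hv.symm
  exact ⟨hinj, LinearMap.injective_iff_surjective.1 hinj⟩

lemma one_le_spectralRadius {A : E →L[ℂ] E} {c : ℂ} (hc : ‖c‖ = 1) (h : c ∈ spectrum ℂ A) :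
    1 ≤ spectralRadius ℂ A := by
  have h1 : (‖c‖₊ : ENNReal) ≤ spectralRadius ℂ A :=
    le_iSup₂ (f := fun (k : ℂ) (_ : k ∈ spectrum ℂ A) => (‖k‖₊ : ENNReal)) c h
  have h2 : ‖c‖₊ = 1 := NNReal.eq hc
  simpa [h2] using h1

lemma spectralRadius_lt_one [CompleteSpace E] {A : E →L[ℂ] E}
    (h : ∀ c ∈ spectrum ℂ A, ‖c‖ < 1) : spectralRadius ℂ A < 1 := by
  -- The spectrum is empty when `E = 0`.
  rcases (spectrum ℂ A).eq_empty_or_nonempty with h0 | h0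
  · simp [spectralRadius, h0]
  · exact_mod_cast spectrum.spectralRadius_lt_of_forall_lt_of_nonempty h0 (r := 1)
      fun k hk => by exact_mod_cast h k hk

variable [CompleteSpace E]

/-- A vector at which a boundary point of the unit disc is attained by the numerical range of an
operator of numerical radius at most one. -/
lemma add_star_apply_eq_of_inner_eq {A : E →L[ℂ] E} (hA : ∀ x, ‖inner ℂ x (A x)‖ ≤ ‖x‖ ^ 2)
    {c : ℂ} (hc : ‖c‖ = 1) {v : E} (hv : c * inner ℂ v (A v) = (‖v‖ ^ 2 : ℝ)) :
    c • A v + star c • star A v = (2 : ℂ) • v := by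
  -- `T = 2 - 2 Re (c A)` is positive by the numerical radius bound, and its quadratic form vanishes
  -- at `v`; writing `T = B* B` gives `T v = 0`.
  set T : E →L[ℂ] E := (2 : ℂ) • 1 - (c • A + star c • star A) with hT
  have hinner : ∀ x, inner ℂ x (T x) =
      ((2 * ‖x‖ ^ 2 - 2 * (c * inner ℂ x (A x)).re : ℝ) : ℂ) := by
    intro x
    have e : inner ℂ x (star A x) = (starRingEnd ℂ) (inner ℂ x (A x)) := by
      rw [ContinuousLinearMap.star_eq_adjoint, ContinuousLinearMap.adjoint_inner_right,
        inner_conj_symm]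
    have e2 := Complex.add_conj (c * inner ℂ x (A x))
    rw [map_mul] at e2
    simp only [hT, sub_apply, add_apply, smul_apply, one_apply_eq_self, inner_sub_right,
      inner_add_right, inner_smul_right, e, inner_self_eq_norm_sq_to_K, Complex.star_def]
    rw [e2]
    push_cast
    rfl
  have hsa : IsSelfAdjoint T := by
    rw [IsSelfAdjoint, hT, star_sub, star_add, star_smul, star_smul, star_smul, star_star,
      star_star, star_one, add_comm]
    congr 2
    simp
  have hpos : 0 ≤ T := by
    rw [ContinuousLinearMap.nonneg_iff_isPositive, ContinuousLinearMap.isPositive_def']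
    refine ⟨hsa, fun x => ?_⟩
    rw [ContinuousLinearMap.reApplyInnerSelf_apply, inner_re_symm, hinner]
    have h1 := (Complex.re_le_norm (c * inner ℂ x (A x)))
    rw [norm_mul, hc, one_mul] at h1
    have h2 := hA x
    simp only [RCLike.re_to_complex, Complex.ofReal_re]
    linarith
  obtain ⟨B, hB⟩ := CStarAlgebra.nonneg_iff_eq_star_mul_self.1 hpos
  have h0 : inner ℂ v (T v) = 0 := by
    rw [hinner, hv, Complex.ofReal_re]; simp
  have hBv : B v = 0 := by
    rw [hB, mul_apply_eq_comp, ContinuousLinearMap.star_eq_adjoint,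
      ContinuousLinearMap.adjoint_inner_right, inner_self_eq_zero] at h0
    exact h0
  have hTv : T v = 0 := by rw [hB, mul_apply_eq_comp, hBv, map_zero]
  rw [hT] at hTv
  simp only [sub_apply, add_apply, smul_apply, one_apply_eq_self] at hTv
  exact (sub_eq_zero.1 hTv).symm

/-- If `s = z₁ + z₂` is an eigenvalue of the pencil `A* + p A` at `p = z₁ z₂`, where `z₁` is
unimodular and `|z₂| < 1`, then `conj z₁` is an eigenvalue of `A`. -/
lemma apply_eq_smul_of_pencil {A : E →L[ℂ] E} (hA : ∀ x, ‖inner ℂ x (A x)‖ ≤ ‖x‖ ^ 2)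
    {z₁ z₂ : ℂ} (h1 : ‖z₁‖ = 1) (h2 : ‖z₂‖ < 1) {v : E}
    (hv : star A v + (z₁ * z₂) • A v = (z₁ + z₂) • v) : A v = star z₁ • v := by
  have hz : star z₁ * z₁ = 1 := by
    rw [Complex.star_def, Complex.conj_mul', h1]; norm_num
  set a := inner ℂ v (A v) with ha
  set N : ℂ := ((‖v‖ ^ 2 : ℝ) : ℂ) with hN
  have hNN : inner ℂ v v = N := by
    rw [inner_self_eq_norm_sq_to_K, hN]; push_cast; rfl
  have e1 : star a + z₁ * z₂ * a = (z₁ + z₂) * N := by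
    have := congrArg (fun x => inner ℂ v x) hv
    simp only [inner_add_right, inner_smul_right, hNN] at this
    rw [← this, ContinuousLinearMap.star_eq_adjoint, ContinuousLinearMap.adjoint_inner_right,
      ← inner_conj_symm]
    rfl
  -- The pencil equation paired with `v`. As `|z₁| = 1`, the two differences have equal modulus, so
  -- `|z₂| < 1` forces both to vanish: the numerical range attains its bound at `v`.
  have e2 : star a - z₁ * N = z₂ * (N - z₁ * a) := by linear_combination e1
  have e3 : ‖N - z₁ * a‖ = ‖star a - z₁ * N‖ := by
    have : star (star a - z₁ * N) = -(star z₁ * (N - z₁ * a)) := by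
      have : star N = N := by rw [hN, Complex.star_def, Complex.conj_ofReal]
      rw [star_sub, star_star, star_mul, this]
      linear_combination -a * hz
    rw [← norm_star (star a - z₁ * N), this, norm_neg, norm_mul, norm_star, h1, one_mul]
  have e4 : star a - z₁ * N = 0 := by
    have := congrArg norm e2
    rw [norm_mul, e3] at this
    rw [← norm_eq_zero]
    nlinarith [norm_nonneg (star a - z₁ * N)]
  have e5 : z₁ * a = N := by
    rw [← sub_eq_zero, ← neg_eq_zero, neg_sub, ← norm_eq_zero, e3, e4, norm_zero]
  have e6 := add_star_apply_eq_of_inner_eq hA h1 e5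
  have e7 : star A v = (2 * z₁) • v - (z₁ * z₁) • A v := by
    have := congrArg (fun x => z₁ • x) e6
    simp only [smul_add, smul_smul, mul_comm z₁ (star z₁), hz, one_smul] at this
    rw [mul_comm 2 z₁, ← this]
    abel
  have hne : z₁ - z₂ ≠ 0 := fun h => by
    rw [sub_eq_zero.1 h] at h1; exact h2.ne h1
  have e8 : (z₁ - z₂) • (v - z₁ • A v) = 0 := by
    rw [e7] at hv
    have := sub_eq_zero.2 hv
    rw [← this]
    module
  have e9 := sub_eq_zero.1 ((smul_eq_zero.1 e8).resolve_left hne)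
  conv_rhs => rw [e9, smul_smul, hz, one_smul]

end Eigen

/-! ## Pure `Γ`-isometries -/

section Isometry

variable {H : Type u} [NormedAddCommGroup H] [InnerProductSpace ℂ H] [CompleteSpace H]

lemma IsGammaIsometry.isGammaContraction {S P : H →L[ℂ] H} (h : IsGammaIsometry S P) :
    IsGammaContraction S P := by
  obtain ⟨K, _, _, _, V, S', P', hu, hV⟩ := h
  exact hu.isGammaContraction.restrict V (fun x => (hV x).1) fun x => (hV x).2

lemma IsGammaIsometry.star_mul_self_snd {S P : H →L[ℂ] H} (h : IsGammaIsometry S P) :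
    star P * P = 1 := by
  obtain ⟨K, _, _, _, V, S', P', hu, hV⟩ := h
  refine ContinuousLinearMap.ext fun x => ext_inner_left ℂ fun y => ?_
  rw [mul_apply_eq_comp, ContinuousLinearMap.star_eq_adjoint,
    ContinuousLinearMap.adjoint_inner_right, ← V.inner_map_map, ← (hV x).2, ← (hV y).2,
    ← ContinuousLinearMap.adjoint_inner_right, ← ContinuousLinearMap.star_eq_adjoint,
    ← mul_apply_eq_comp, hu.star_mul_self_snd]
  exact V.inner_map_map y x

lemma IsGammaIsometry.star_fst_mul_snd {S P : H →L[ℂ] H} (h : IsGammaIsometry S P) :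
    star S * P = S := by
  obtain ⟨K, _, _, _, V, S', P', hu, hV⟩ := h
  refine ContinuousLinearMap.ext fun x => ext_inner_left ℂ fun y => ?_
  rw [mul_apply_eq_comp, ContinuousLinearMap.star_eq_adjoint,
    ContinuousLinearMap.adjoint_inner_right, ← V.inner_map_map, ← (hV x).2, ← (hV y).1,
    ← ContinuousLinearMap.adjoint_inner_right, ← ContinuousLinearMap.star_eq_adjoint,
    ← mul_apply_eq_comp, hu.star_fst_mul_snd, (hV x).1]
  exact V.inner_map_map y (S x)

lemma IsGammaIsometry.star_fst {S P : H →L[ℂ] H} (h : IsGammaIsometry S P) :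
    star S = star P * S := by
  conv_lhs => rw [← h.star_fst_mul_snd, star_mul, star_star]

lemma isSelfAdjoint_defect (P : H →L[ℂ] H) : IsSelfAdjoint (1 - P * star P) :=
  (IsSelfAdjoint.one _).sub (IsSelfAdjoint.mul_star_self P)

/-- For an isometry `P`, `1 - P P*` is a projection, hence its own positive square root. -/
lemma defectOp_adjoint {P : H →L[ℂ] H} (h : star P * P = 1) :
    defectOp (ContinuousLinearMap.adjoint P) = 1 - P * star P := by
  have hid : (1 - P * star P) * (1 - P * star P) = 1 - P * star P := by
    have : P * star P * (P * star P) = P * star P := by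
      rw [mul_assoc, ← mul_assoc (star P), h, one_mul]
    rw [sub_mul, mul_sub, mul_sub, this]
    simp
  have hpos : 0 ≤ 1 - P * star P := by
    have := star_mul_self_nonneg (1 - P * star P)
    rwa [(isSelfAdjoint_defect P).star_eq, hid] at this
  rw [defectOp, ContinuousLinearMap.adjoint_adjoint, ← ContinuousLinearMap.star_eq_adjoint]
  exact CFC.sqrt_unique hid hpos

lemma mem_defectSpace_adjoint {P : H →L[ℂ] H} (h : star P * P = 1) {x : H} :
    x ∈ defectSpace (ContinuousLinearMap.adjoint P) ↔ star P x = 0 := by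
  constructor
  · intro hx
    have hcl : IsClosed {x : H | star P x = 0} := isClosed_eq (star P).continuous continuous_const
    refine closure_minimal ?_ hcl hx
    rintro _ ⟨y, rfl⟩
    change star P (defectOp (ContinuousLinearMap.adjoint P) y) = 0
    rw [defectOp_adjoint h, ← mul_apply_eq_comp, mul_sub, ← mul_assoc, h]
    simp
  · intro hx
    refine Submodule.le_topologicalClosure _ ⟨x, ?_⟩
    change defectOp (ContinuousLinearMap.adjoint P) x = x
    rw [defectOp_adjoint h, sub_apply, mul_apply_eq_comp, hx]
    simp

/-- The fundamental operator of `(S*, P*)` is the restriction of `S*` to `ker P*`. -/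
lemma IsGammaIsometry.fundamental_apply {S P : H →L[ℂ] H} (h : IsGammaIsometry S P)
    {F : defectSpace (ContinuousLinearMap.adjoint P) →L[ℂ]
      defectSpace (ContinuousLinearMap.adjoint P)}
    (hF : IsFundamentalOperator (ContinuousLinearMap.adjoint S) (ContinuousLinearMap.adjoint P) F)
    (e : defectSpace (ContinuousLinearMap.adjoint P)) : star S e = (F e : H) := by
  have hP := h.star_mul_self_snd
  have hfix : ∀ e : defectSpace (ContinuousLinearMap.adjoint P),
      defectOp (ContinuousLinearMap.adjoint P) e = e := fun e => by
    rw [defectOp_adjoint hP, sub_apply, mul_apply_eq_comp, (mem_defectSpace_adjoint hP).1 e.2]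
    simp
  have he : defectMap (ContinuousLinearMap.adjoint P) e = e := Subtype.ext (hfix e)
  have := DFunLike.congr_fun hF (e : H)
  rw [ContinuousLinearMap.adjoint_adjoint] at this
  change star S e - S (star P e) = defectOp (ContinuousLinearMap.adjoint P)
    (F (defectMap (ContinuousLinearMap.adjoint P) e) : H) at this
  rw [he, hfix, (mem_defectSpace_adjoint hP).1 e.2, map_zero, sub_zero] at this
  exact this

lemma IsGammaIsometry.star_snd_star_fst_apply {S P : H →L[ℂ] H} (h : IsGammaIsometry S P)
    {v : H} (hv : star P v = 0) : star P (star S v) = 0 := by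
  rw [← mul_apply_eq_comp, (h.isGammaContraction.1.star_star).eq.symm, mul_apply_eq_comp, hv,
    map_zero]

/-- The compression of `S*` to `ker P*` has numerical radius at most one. -/
lemma IsGammaIsometry.norm_inner_star_le {S P : H →L[ℂ] H} (h : IsGammaIsometry S P)
    {v : H} (hv : star P v = 0) : ‖inner ℂ v (star S v)‖ ≤ ‖v‖ ^ 2 := by
  set a := inner ℂ v (star S v) with ha
  have hPi : ∀ x, ‖P x‖ = ‖x‖ := by
    refine (ContinuousLinearMap.norm_map_iff_adjoint_comp_self P).2 ?_
    exact h.star_mul_self_snd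
  have hPn : ‖P‖ ≤ 1 := ContinuousLinearMap.opNorm_le_bound _ zero_le_one fun x => by
    rw [hPi, one_mul]
  have adj : ∀ (T : H →L[ℂ] H) x y, inner ℂ x (star T y) = inner ℂ (T x) y := fun T x y => by
    rw [ContinuousLinearMap.star_eq_adjoint, ContinuousLinearMap.adjoint_inner_right]
  have adj' : ∀ (T : H →L[ℂ] H) x y, inner ℂ (star T x) y = inner ℂ x (T y) := fun T x y => by
    rw [ContinuousLinearMap.star_eq_adjoint, ContinuousLinearMap.adjoint_inner_left]
  -- Test `‖S‖ ≤ 2` on `x = (1 - w P)⁻¹ v = ∑ wⁿ Pⁿ v`. Since `v ⊥ Ran P`, `(1 - |w|²) ‖x‖² = ‖v‖²`;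
  -- and `S* = P* S` gives `(1 - |w|²) ⟨x, S x⟩ = conj a + conj w * a`.
  have main : ∀ w : ℂ, ‖w‖ < 1 → ‖star a + star w * a‖ ≤ 2 * ‖v‖ ^ 2 := by
    intro w hw
    have hu : IsUnit (1 - w • P) := by
      refine isUnit_one_sub_of_norm_lt_one ?_
      rw [norm_smul]
      nlinarith [norm_nonneg w, norm_nonneg P]
    obtain ⟨x, hx⟩ := ((ContinuousLinearMap.isUnit_iff_bijective).1 hu).2 v
    have hx' : x = v + w • P x := by
      rw [← hx]; simp
    have hvP : ∀ y, inner ℂ v (P y) = 0 := fun y => by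
      rw [← adj', hv, inner_zero_left]
    have hnorm : (1 - ‖w‖ ^ 2) * ‖x‖ ^ 2 = ‖v‖ ^ 2 := by
      have := norm_add_sq_eq_norm_sq_add_norm_sq_of_inner_eq_zero (𝕜 := ℂ) v (w • P x)
        (by rw [inner_smul_right, hvP, mul_zero])
      rw [← hx', norm_smul, hPi] at this
      linear_combination this
    set t := inner ℂ x (S x) with ht
    have t1 : t = star a + star w * star t := by
      have i1 : inner ℂ v (S x) = star a := by
        conv_lhs => rw [hx']
        rw [← adj', inner_add_right, inner_smul_right, ← adj' P,
          h.star_snd_star_fst_apply hv, inner_zero_left, mul_zero, add_zero, ← inner_conj_symm]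
        rfl
      have i2 : inner ℂ (P x) (S x) = star t := by
        rw [← adj, ← mul_apply_eq_comp, ← h.star_fst, adj, ← inner_conj_symm]
        rfl
      calc t = inner ℂ (v + w • P x) (S x) := by rw [ht, ← hx']
        _ = _ := by rw [inner_add_left, inner_smul_left, i1, i2]; rfl
    have t2 : star t = a + w * t := by
      conv_lhs => rw [t1]
      simp
    have hww : star w * w = ((‖w‖ ^ 2 : ℝ) : ℂ) := by
      rw [Complex.star_def, Complex.conj_mul']; push_cast; rfl
    have t3 : star a + star w * a = ((1 - ‖w‖ ^ 2 : ℝ) : ℂ) * t := by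
      push_cast at hww ⊢
      rw [t2] at t1
      linear_combination -t1 - t * hww
    have htn : ‖t‖ ≤ 2 * ‖x‖ ^ 2 := by
      refine (norm_inner_le_norm _ _).trans ?_
      have := (S.le_opNorm x).trans (mul_le_mul_of_nonneg_right
        h.isGammaContraction.norm_fst_le (norm_nonneg x))
      nlinarith [norm_nonneg x]
    have h1 : 0 ≤ 1 - ‖w‖ ^ 2 := by nlinarith [norm_nonneg w]
    rw [t3, norm_mul, Complex.norm_real, Real.norm_eq_abs, abs_of_nonneg h1, ← hnorm]
    nlinarith [mul_le_mul_of_nonneg_left htn h1]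
  by_contra! hlt
  have hpos : 0 < ‖a‖ := (sq_nonneg _).trans_lt hlt
  have ha0 : a ≠ 0 := norm_pos_iff.1 hpos
  -- With `conj w = r * conj a / a` the two terms are aligned and `(1 + r) |a| = |a| + ‖v‖²`, which
  -- exceeds `2 ‖v‖²`; no limit `r → 1` is needed.
  set r : ℝ := ‖v‖ ^ 2 / ‖a‖ with hr
  have hr0 : 0 ≤ r := by positivity
  have hra : r * ‖a‖ = ‖v‖ ^ 2 := by rw [hr]; field_simp
  have hr1 : r < 1 := (div_lt_one hpos).2 hlt
  have := main (star ((r : ℂ) * (star a / a))) (by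
    rw [norm_star, norm_mul, norm_div, norm_star, div_self hpos.ne', mul_one, Complex.norm_real,
      Real.norm_eq_abs, abs_of_nonneg hr0]
    exact hr1)
  have e : star a + star (star ((r : ℂ) * (star a / a))) * a = ((1 + r : ℝ) : ℂ) * star a := by
    rw [star_star]; push_cast; field_simp
  rw [e, norm_mul, norm_star, Complex.norm_real, Real.norm_eq_abs, abs_of_nonneg (by linarith)]
    at this
  nlinarith

/-- An operator commuting with a pure isometry `P` and vanishing on `ker P*` is zero. -/
lemma eq_zero_of_commute_of_pure {P T : H →L[ℂ] H} (hP : star P * P = 1)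
    (hpure : ∀ x, Tendsto (fun n : ℕ => (star P ^ n) x) atTop (𝓝 0)) (hT : Commute T P)
    (h : ∀ e, star P e = 0 → T e = 0) : T = 0 := by
  have hPi : ∀ x, ‖P x‖ = ‖x‖ :=
    (ContinuousLinearMap.norm_map_iff_adjoint_comp_self P).2 hP
  -- `T` kills the range of `1 - P P*`, which is `ker P*`. Iterating, `‖T x‖ = ‖T P*ⁿ x‖`, which
  -- tends to 0.
  have h1 : T = P * T * star P := by
    rw [← hT.eq, mul_assoc, ← sub_eq_zero]
    ext x
    have : T (x - P (star P x)) = 0 := h _ (by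
      rw [map_sub, ← mul_apply_eq_comp (star P), hP]; simp)
    rw [map_sub] at this
    exact this
  have h2 : ∀ n : ℕ, ∀ x, ‖T x‖ = ‖T ((star P ^ n) x)‖ := by
    intro n
    induction n with
    | zero => simp
    | succ n ih =>
      intro x
      rw [ih]
      conv_lhs => rw [h1]
      rw [mul_apply_eq_comp, mul_apply_eq_comp, hPi, ← mul_apply_eq_comp (star P), ← pow_succ']
  ext x
  have h3 : Tendsto (fun n : ℕ => ‖T ((star P ^ n) x)‖) atTop (𝓝 ‖T 0‖) :=
    ((T.continuous.tendsto 0).comp (hpure x)).norm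
  simp only [← h2] at h3
  rw [map_zero, norm_zero] at h3
  simpa using tendsto_nhds_unique tendsto_const_nhds h3

end Isometry

/-! ## Distinguished polynomials -/

lemma evalPoint_mul (p q : MvPolynomial (Fin 2) ℂ) (z : ℂ × ℂ) :
    evalPoint (p * q) z = evalPoint p z * evalPoint q z := map_mul _ _ _

lemma star_symm (w : ℂ × ℂ) : star (symm w) = symm (star w) := by
  ext <;> simp [symm]

lemma IsGammaDistinguishedPoly.conjPoly {q : MvPolynomial (Fin 2) ℂ}
    (hq : IsGammaDistinguishedPoly q) : IsGammaDistinguishedPoly (conjPoly q) := by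
  have hzero : ∀ z, z ∈ zeroSet (GammaPair.conjPoly q) → star z ∈ zeroSet q := fun z hz => by
    have : evalPoint (GammaPair.conjPoly q) z = 0 := hz
    rw [evalPoint_conjPoly, star_eq_zero] at this
    exact this
  obtain ⟨⟨z, hz, w, ⟨h1, h2⟩, rfl⟩, hsub⟩ := hq
  refine ⟨⟨star (symm w), ?_, star w, ⟨by simpa using h1, by simpa using h2⟩,
    (star_symm w).symm⟩, ?_⟩
  · change evalPoint _ _ = 0
    rw [evalPoint_conjPoly, star_star, star_eq_zero]
    exact hz
  · refine subset_antisymm ?_ fun z hz => ⟨hz.1, distBoundary_subset_frontier hz.2⟩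
    rintro z ⟨hz, hzf⟩
    refine ⟨hz, ?_⟩
    obtain ⟨v, hv1, hv2, rfl⟩ := exists_of_mem_frontier hzf
    have hmem : star (symm v) ∈ zeroSet q ∩ frontier closedSymmBidisc := by
      refine ⟨hzero _ hz, ?_⟩
      rw [star_symm]
      exact symm_mem_frontier (by simpa using hv1) (by simpa using hv2)
    rw [hsub] at hmem
    obtain ⟨x, ⟨hx1, hx2⟩, hx⟩ := hmem.2
    exact ⟨star x, ⟨by simpa using hx1, by simpa using hx2⟩, by
      rw [← star_symm, hx, star_star]⟩

/-- The factor `s` supplies the zero `(0, 0)` in `𝔾₂`, which `q` alone may lack (the determinant is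
1 when `ker P* = 0`). It is harmless on `∂Γ`: `z₁ + z₂ = 0` gives `|z₁| = |z₂|`. -/
lemma isGammaDistinguishedPoly_X_mul {q : MvPolynomial (Fin 2) ℂ}
    (hq : ∀ w : ℂ × ℂ, ‖w.1‖ = 1 → ‖w.2‖ < 1 → evalPoint q (symm w) ≠ 0) :
    IsGammaDistinguishedPoly (MvPolynomial.X 0 * q) := by
  refine ⟨⟨0, ?_, 0, by simp, by simp [symm]⟩, ?_⟩
  · change evalPoint _ _ = 0
    rw [evalPoint_mul]
    simp [evalPoint]
  · refine subset_antisymm ?_ fun z hz => ⟨hz.1, distBoundary_subset_frontier hz.2⟩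
    rintro z ⟨hz, hzf⟩
    refine ⟨hz, ?_⟩
    obtain ⟨w, h1, h2, rfl⟩ := exists_of_mem_frontier hzf
    refine ⟨w, ⟨h1, ?_⟩, rfl⟩
    by_contra hne
    have h2' : ‖w.2‖ < 1 := lt_of_le_of_ne h2 hne
    have hz' : evalPoint (MvPolynomial.X 0 * q) (symm w) = 0 := hz
    rw [evalPoint_mul] at hz'
    have h3 := (mul_eq_zero.1 hz').resolve_right (hq w h1 h2')
    have h4 : w.1 + w.2 = 0 := by simpa [evalPoint, symm] using h3
    rw [eq_neg_of_add_eq_zero_right h4, norm_neg, h1] at h2'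
    exact lt_irrefl _ h2'

/-! ## The determinant of the pencil `A + p B` -/

section Pencil

variable {E : Type*} [NormedAddCommGroup E] [InnerProductSpace ℂ E] [FiniteDimensional ℂ E]

/-- The matrix of `s - A - p B` with polynomial entries. -/
noncomputable def pencilMatrix (A B : E →L[ℂ] E) :
    Matrix (Fin (Module.finrank ℂ E)) (Fin (Module.finrank ℂ E)) (MvPolynomial (Fin 2) ℂ) :=
  let b := Module.finBasis ℂ E
  Matrix.scalar _ (MvPolynomial.X 0) -
    (LinearMap.toMatrix b b A.toLinearMap).map MvPolynomial.C -
    (MvPolynomial.X 1 : MvPolynomial (Fin 2) ℂ) •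
      (LinearMap.toMatrix b b B.toLinearMap).map MvPolynomial.C

lemma exists_eigenvector_of_det_pencilMatrix {A B : E →L[ℂ] E} {z : ℂ × ℂ}
    (h : evalPoint (pencilMatrix A B).det z = 0) :
    ∃ v : E, v ≠ 0 ∧ A v + z.2 • B v = z.1 • v := by
  set b := Module.finBasis ℂ E
  set L : E →ₗ[ℂ] E := z.1 • LinearMap.id - A.toLinearMap - z.2 • B.toLinearMap with hL
  have hdet : LinearMap.det L = 0 := by
    rw [← LinearMap.det_toMatrix b, ← h, evalPoint, RingHom.map_det]
    congr 1
    rw [hL, map_sub, map_sub, map_smul, map_smul, LinearMap.toMatrix_id]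
    ext i j
    by_cases hij : i = j <;>
      simp [pencilMatrix, Matrix.scalar_apply, b, hij]
  obtain ⟨v, hv, hne⟩ := (Submodule.ne_bot_iff _).1 (LinearMap.bot_lt_ker_of_det_eq_zero hdet).ne'
  refine ⟨v, hne, ?_⟩
  have : z.1 • v - A v - z.2 • B v = 0 := hv
  rw [sub_sub, sub_eq_zero] at this
  exact this.symm

/-- Cayley–Hamilton for a pencil: if `S = A + P B` on a finite-dimensional subspace, then
`det (s - A - p B)` annihilates this subspace at `(S, P)`. -/
lemma evalPair_det_pencilMatrix_apply {H : Type u} [NormedAddCommGroup H] [InnerProductSpace ℂ H]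
    [CompleteSpace H] {S P : H →L[ℂ] H} (hc : Commute S P) {A B : E →L[ℂ] E} (V : E →ₗ[ℂ] H)
    (h : ∀ e, S (V e) = V (A e) + P (V (B e))) (e : E) :
    evalPair (pencilMatrix A B).det S P (V e) = 0 := by
  obtain ⟨R, _, _, _, φ, x, y, rfl, rfl, -⟩ := exists_commBanachAlgebra hc
  rw [evalPair_algHom]
  set Ψ : MvPolynomial (Fin 2) ℂ →ₐ[ℂ] (H →L[ℂ] H) := φ.comp (MvPolynomial.aeval ![x, y])
  change Ψ _ _ = 0
  set b := Module.finBasis ℂ E with hb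
  set N := pencilMatrix A B with hN
  have hrow : ∀ j, ∑ i, Ψ (N i j) (V (b i)) = 0 := by
    intro j
    have hA : ∑ i, LinearMap.toMatrix b b A.toLinearMap i j • V (b i) = V (A (b j)) := by
      conv_rhs => rw [← Module.Basis.sum_repr b (A (b j))]
      simp only [LinearMap.toMatrix_apply, map_sum, map_smul]
      rfl
    have hB : ∑ i, LinearMap.toMatrix b b B.toLinearMap i j • φ y (V (b i)) =
        φ y (V (B (b j))) := by
      conv_rhs => rw [← Module.Basis.sum_repr b (B (b j))]
      simp only [LinearMap.toMatrix_apply, map_sum, map_smul]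
      rfl
    have hentry : ∀ i, Ψ (N i j) (V (b i)) = (if i = j then φ x (V (b i)) else 0) -
        LinearMap.toMatrix b b A.toLinearMap i j • V (b i) -
        LinearMap.toMatrix b b B.toLinearMap i j • φ y (V (b i)) := by
      intro i
      have hX0 : Ψ (MvPolynomial.X 0) = φ x := by simp [Ψ]
      have hX1 : Ψ (MvPolynomial.X 1) = φ y := by simp [Ψ]
      have hC : ∀ c : ℂ, Ψ (MvPolynomial.C c) = c • (1 : H →L[ℂ] H) := fun c => by
        rw [← MvPolynomial.algebraMap_eq, AlgHom.commutes, Algebra.algebraMap_eq_smul_one]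
      have : N i j = (if i = j then MvPolynomial.X 0 else 0) -
          MvPolynomial.C (LinearMap.toMatrix b b A.toLinearMap i j) -
          MvPolynomial.X 1 * MvPolynomial.C (LinearMap.toMatrix b b B.toLinearMap i j) := by
        simp [hN, pencilMatrix, Matrix.scalar_apply, Matrix.diagonal_apply, hb]
      rw [this, map_sub, map_sub, map_mul, hC, hC, hX1, apply_ite Ψ, hX0, map_zero]
      split_ifs <;> simp
    simp only [hentry, Finset.sum_sub_distrib, hA, hB, Finset.sum_ite_eq', Finset.mem_univ,
      if_true, h]
    abel
  have hbasis : ∀ k, Ψ N.det (V (b k)) = 0 := by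
    intro k
    -- The relations `hrow` hold column by column; multiplying them by the adjugate, whose entries
    -- commute with everything in sight, leaves the determinant alone on each basis vector.
    have e1 : ∑ i, Ψ ((N * N.adjugate) i k) (V (b i)) = 0 := by
      simp only [Matrix.mul_apply, map_sum, sum_apply]
      rw [Finset.sum_comm]
      refine Finset.sum_eq_zero fun j _ => ?_
      have : ∀ i, Ψ (N i j * N.adjugate j k) (V (b i)) =
          Ψ (N.adjugate j k) (Ψ (N i j) (V (b i))) := fun i => by
        rw [mul_comm, map_mul]; rfl
      simp only [this]
      rw [← map_sum, hrow, map_zero]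
    rw [Matrix.mul_adjugate] at e1
    rw [← e1, Finset.sum_eq_single k]
    · simp
    · intro i _ hik
      simp [hik]
    · simp
  have : (Ψ N.det).toLinearMap ∘ₗ V = 0 := b.ext fun k => hbasis k
  exact DFunLike.congr_fun this e

end Pencil

/-! ### The three implications. -/

section Main

variable {H : Type u} [NormedAddCommGroup H] [InnerProductSpace ℂ H] [CompleteSpace H]
variable {S P : H →L[ℂ] H}
  {F : defectSpace (ContinuousLinearMap.adjoint P) →L[ℂ]
    defectSpace (ContinuousLinearMap.adjoint P)}

/-- `S = F_*^* + P F_*` on `ker P*`. -/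
lemma IsGammaIsometry.fst_apply [CompleteSpace (defectSpace (ContinuousLinearMap.adjoint P))]
    (h : IsGammaIsometry S P)
    (hF : IsFundamentalOperator (ContinuousLinearMap.adjoint S) (ContinuousLinearMap.adjoint P) F)
    (e : defectSpace (ContinuousLinearMap.adjoint P)) :
    S e = (star F e : H) + P (F e : H) := by
  have hP := h.star_mul_self_snd
  -- `P*` sends this vector to `P* S e - F e = S* e - F e = 0`. Pairing it with `v` in `ker P*`
  -- gives `⟨S* v, e⟩ = ⟨F v, e⟩`, which identifies it as `F* e`.
  have hmem : S e - P (F e : H) ∈ defectSpace (ContinuousLinearMap.adjoint P) := by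
    rw [mem_defectSpace_adjoint hP, map_sub, ← mul_apply_eq_comp, ← mul_apply_eq_comp, hP,
      ← h.star_fst, h.fundamental_apply hF]
    simp
  have hv0 : ∀ v : defectSpace (ContinuousLinearMap.adjoint P),
      ContinuousLinearMap.adjoint P v = 0 := fun v => (mem_defectSpace_adjoint hP).1 v.2
  have : star F e = ⟨_, hmem⟩ := by
    refine ext_inner_left ℂ fun v => ?_
    rw [ContinuousLinearMap.star_eq_adjoint, ContinuousLinearMap.adjoint_inner_right,
      Submodule.coe_inner, Submodule.coe_inner, ← h.fundamental_apply hF v, inner_sub_right,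
      ContinuousLinearMap.star_eq_adjoint, ContinuousLinearMap.adjoint_inner_left,
      ← ContinuousLinearMap.adjoint_inner_left P, hv0, inner_zero_left, sub_zero]
  rw [this]
  simp

lemma IsGammaIsometry.isGammaContraction_fundamental
    [CompleteSpace (defectSpace (ContinuousLinearMap.adjoint P))]
    (h : IsGammaIsometry S P)
    (hF : IsFundamentalOperator (ContinuousLinearMap.adjoint S)
      (ContinuousLinearMap.adjoint P) F) : IsGammaContraction F 0 :=
  h.isGammaContraction.adjoint.restrict (Submodule.subtypeₗᵢ _)
    (fun e => h.fundamental_apply hF e) fun e => by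
      have := (mem_defectSpace_adjoint h.star_mul_self_snd).1 e.2
      simpa using this

lemma IsGammaDistinguished.fundamental
    [CompleteSpace (defectSpace (ContinuousLinearMap.adjoint P))]
    (hd : IsGammaDistinguished S P) (h : IsGammaIsometry S P)
    (hF : IsFundamentalOperator (ContinuousLinearMap.adjoint S)
      (ContinuousLinearMap.adjoint P) F) : IsGammaDistinguished F 0 := by
  obtain ⟨hcon, q, hq, hq0⟩ := hd
  refine ⟨h.isGammaContraction_fundamental hF, conjPoly q, hq.conjPoly, ?_⟩
  have := evalPair_intertwine (S := F) (P := 0) (S' := star S) (P' := star P)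
    (V := (defectSpace (ContinuousLinearMap.adjoint P)).subtypeL)
    (ContinuousLinearMap.ext fun e => h.fundamental_apply hF e)
    (ContinuousLinearMap.ext fun e => by
      have := (mem_defectSpace_adjoint h.star_mul_self_snd).1 e.2
      simpa using this) (conjPoly q)
  rw [adjoint_evalPair hcon.1, hq0, star_zero] at this
  refine ContinuousLinearMap.ext fun e => Subtype.ext ?_
  exact (DFunLike.congr_fun this e).symm

lemma IsGammaDistinguished.spectralRadius_lt_one {E : Type*} [NormedAddCommGroup E]
    [InnerProductSpace ℂ E] [FiniteDimensional ℂ E] {A : E →L[ℂ] E}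
    (h : IsGammaDistinguished A 0) : spectralRadius ℂ A < 1 := by
  have := FiniteDimensional.complete ℂ E
  obtain ⟨⟨-, hσ, -⟩, q, ⟨-, hq⟩, hq0⟩ := h
  refine GammaPair.spectralRadius_lt_one fun c hc => ?_
  obtain ⟨v, hv, hAv⟩ := exists_apply_eq_smul_of_mem_spectrum hc
  -- The eigenvector is a common kernel vector, so exactness fails at the first place of the Koszul
  -- complex.
  have hmem : (c, (0 : ℂ)) ∈ closedSymmBidisc := hσ fun hex => hv <| hex.1 v
    (by simp [hAv]) (by simp)
  refine lt_of_le_of_ne (norm_fst_le_one_of_mem hmem) fun h1 => ?_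
  have hsymm : symm (c, 0) = (c, 0) := by simp [symm]
  -- The line through `v` intertwines the scalar pair `(c, 0)` with `(A, 0)`, so `q(c, 0) v = q(A,
  -- 0) v = 0`.
  have hz : evalPoint q (c, 0) = 0 := by
    let V : ℂ →L[ℂ] E := ContinuousLinearMap.toSpanSingleton ℂ v
    have e1 := evalPair_intertwine (S := c • (1 : ℂ →L[ℂ] ℂ)) (P := (0 : ℂ) • (1 : ℂ →L[ℂ] ℂ))
      (S' := A) (P' := 0) (V := V) (by ext; simp [V, hAv]) (by ext; simp) q
    have e2 := evalPair_algHom (Algebra.ofId ℂ (ℂ →L[ℂ] ℂ)) c 0 q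
    have hid : ∀ a : ℂ, Algebra.ofId ℂ (ℂ →L[ℂ] ℂ) a = a • 1 := fun a =>
      Algebra.algebraMap_eq_smul_one a
    rw [hid, hid, hid] at e2
    rw [hq0, e2] at e1
    have e3 := DFunLike.congr_fun e1 1
    have e4 : MvPolynomial.aeval ![c, 0] q • v = 0 := by simpa [V] using e3.symm
    have e5 := (smul_eq_zero.1 e4).resolve_right hv
    rwa [MvPolynomial.aeval_eq_eval] at e5
  have hb : (c, (0 : ℂ)) ∈ zeroSet q ∩ frontier closedSymmBidisc :=
    ⟨hz, hsymm ▸ symm_mem_frontier (w := (c, 0)) h1 (by simp)⟩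
  rw [hq] at hb
  simpa using norm_snd_of_mem_distBoundary hb.2

lemma IsPureGammaIsometry.isGammaDistinguished
    [FiniteDimensional ℂ (defectSpace (ContinuousLinearMap.adjoint P))]
    (h : IsPureGammaIsometry S P)
    (hF : IsFundamentalOperator (ContinuousLinearMap.adjoint S) (ContinuousLinearMap.adjoint P) F)
    (hr : spectralRadius ℂ F < 1) : IsGammaDistinguished S P := by
  have := FiniteDimensional.complete ℂ (defectSpace (ContinuousLinearMap.adjoint P))
  obtain ⟨hiso, -, hpure⟩ := h
  have hP := hiso.star_mul_self_snd
  have hcon := hiso.isGammaContraction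
  refine ⟨hcon, MvPolynomial.X 0 * (pencilMatrix (star F) F).det,
    isGammaDistinguishedPoly_X_mul fun w h1 h2 h0 => ?_, ?_⟩
  · obtain ⟨v, hv, hev⟩ := exists_eigenvector_of_det_pencilMatrix h0
    have hnum : ∀ x, ‖inner ℂ x (F x)‖ ≤ ‖x‖ ^ 2 := fun x => by
      rw [Submodule.coe_inner, ← hiso.fundamental_apply hF]
      exact hiso.norm_inner_star_le ((mem_defectSpace_adjoint hP).1 x.2)
    have hFv := apply_eq_smul_of_pencil hnum h1 h2 hev
    exact absurd (one_le_spectralRadius (by rw [norm_star, h1])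
      (mem_spectrum_of_apply_eq_smul hv hFv)) (not_le.2 hr)
  · have hzero : evalPair (pencilMatrix (star F) F).det S P = 0 := by
      refine eq_zero_of_commute_of_pure hP hpure ?_ fun e he => ?_
      · have := evalPair_commute hcon.1 (pencilMatrix (star F) F).det (MvPolynomial.X 1)
        rwa [evalPair_X_one hcon.1] at this
      · exact evalPair_det_pencilMatrix_apply hcon.1
          (defectSpace (ContinuousLinearMap.adjoint P)).subtype
          (fun e => hiso.fst_apply hF e) ⟨e, (mem_defectSpace_adjoint hP).2 he⟩
    rw [evalPair_mul hcon.1, hzero, mul_zero]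

end Main

end GammaPair

theorem theorem5p7 {H : Type*} [NormedAddCommGroup H] [InnerProductSpace ℂ H] [CompleteSpace H]
    (S P : H →L[ℂ] H) (hSP : GammaPair.IsPureGammaIsometry S P)
    (hdim : FiniteDimensional ℂ (GammaPair.defectSpace (ContinuousLinearMap.adjoint P)))
    (F : GammaPair.defectSpace (ContinuousLinearMap.adjoint P) →L[ℂ]
      GammaPair.defectSpace (ContinuousLinearMap.adjoint P))
    (hF : GammaPair.IsFundamentalOperator (ContinuousLinearMap.adjoint S)
      (ContinuousLinearMap.adjoint P) F) :
    List.TFAE [GammaPair.IsGammaDistinguished F 0, GammaPair.IsGammaDistinguished S P,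
      spectralRadius ℂ F < 1] := by
  have := FiniteDimensional.complete ℂ (GammaPair.defectSpace (ContinuousLinearMap.adjoint P))
  tfae_have 1 → 3 := fun h => h.spectralRadius_lt_one
  tfae_have 3 → 2 := fun h => hSP.isGammaDistinguished hF h
  tfae_have 2 → 1 := fun h => h.fundamental hSP.1 hF
  tfae_finish
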